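/- Let $n,m\in\mathbb N$, $D>0$, $h>0$, and let $f:\mathbb R^n\times\mathbb R^m\to\mathbb R^n$ satisfy: (i) for all compact $X\subset\mathbb R^n$, $V\subset\mathbb R^m$ there is $C_f>0$ with $|f(x_1,u_1)-f(x_2,u_2)|\le C_f(|x_1-x_2|+|u_1-u_2|)$ for $x_1,x_2\in X$, $u_1,u_2\in V$; (ii) $\dot x=f(x,w)$ is strongly forward complete, i.e. there are a $C^\infty$ function $R:\mathbb R^n\to\mathbb R$ and class-$\mathcal K_\infty$ functions $\alpha_1,\alpha_2,\alpha_3$ with $\alpha_1(|x|)\le R(x)\le\alpha_2(|x|)$ and $\nabla R(x)\cdot f(x,w)\le R(x)+\alpha_3(|w|)$ for all $x,w$. Let $\kappa\in C^1(\mathbb R^n;\mathbb R^m)$ be such that the origin of $\dot x=f(x,\kappa(x))$ is globally asymptotically stable. For $X\in\mathbb R^n$ and $U\in C^1([-D,0];\mathbb R^m)$ let $\mathcal P(X,U)\in C^1([-D,0];\mathbb R^n)$ be the solution of $P(s)=X+\int_{-D}^s f(P(\theta),U(\theta))\,d\theta$, $s\in[-D,0]$; for $P\in\mathbb R^n$ let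 $\mathcal Z(P)\in C^1([0,h);\mathbb R^n)$ be the solution of $Z(s)=P+\int_0^s f(Z(\tau),\kappa(Z(\tau)))\,d\tau$, $s\in[0,h)$; and let $\mathcal M(X,U)=\mathcal Z(\mathcal P(X,U)(0))$. Fix an activation function $\sigma\in C^\infty(\mathbb R)$ that is not a polynomial. A neural operator on $[-D,0]$ (here: an averaging neural operator) is a map $u\mapsto Q\circ L_\ell\circ\dots\circ L_1\circ R(u)$ with $\ell\ge1$, $R(u)(x)=R(u(x),x)$, $L_i(v)(x)=\sigma\big(W_iv(x)+b_i+\frac1D\int_{-D}^0 v(y)\,dy\big)$ with $\sigma$ acting componentwise, and $Q(v)(x)=Q(v(x),x)$, where $R$ and $Q$ are neural networks $z\mapsto A\,\sigma(Bz+c)+d$ with one hidden layer. Such an operator $\mathcal N$ induces the map $\hat{\mathcal M}(X,U)(\theta)=\mathcal N\big(x\mapsto(X,U(x))\big)\big(-D+\tfrac Dh\theta\big)$, $\theta\in[0,h)$. Let $\mathcal X\subset\mathbb R^n$, $\mathcal U\subset\mathbb R^m$ be bounded and let $K\subset\mathcal X\times C^1([-D,0];\mathcal U)$ be compact (in the $C^1$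 topology). Then $\mathcal P$, $\mathcal Z$ and hence $\mathcal M$ are well defined (the above solutions exist for all $X$, $U$, $P$), and for every $\epsilon>0$ there is a neural operator whose induced map $\hat{\mathcal M}$ maps $K$ into $C^1([0,h);\mathbb R^n)$ and satisfies, for all $\theta\in[0,h)$, $$\sup_{(X,U)\in K}|\mathcal M(X,U)(\theta)-\hat{\mathcal M}(X,U)(\theta)|<\epsilon .$$ -/

import Mathlib

open Set Filter Topology MeasureTheory
open scoped ContDiff Matrix

noncomputable section

/-- Euclidean space of dimension `d`. -/
abbrev Euc (d : ℕ) : Type := EuclideanSpace ℝ (Fin d)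

/-! ### The space of continuously differentiable functions on a compact interval -/

/-- Extension by zero of a function on `[a, b]` to the real line
(only the values on `[a, b]` are ever used). -/
def extendZero {a b : ℝ} {E : Type} [Zero E] (u : Icc a b → E) (t : ℝ) : E :=
  open Classical in if ht : t ∈ Icc a b then u ⟨t, ht⟩ else 0

/-- `C¹([a, b]; E)`, realised as the set of pairs `(u, u')` of continuous functions on `[a, b]`
such that `u'` is the derivative of `u` (one-sided at the end points).  The norm inherited from
the product, `max (sup ‖u‖) (sup ‖u'‖)`, is the `C¹` norm. -/
def C1Space (a b : ℝ) (E : Type) [NormedAddCommGroup E] [NormedSpace ℝ E] :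
    Submodule ℝ (C(Icc a b, E) × C(Icc a b, E)) where
  carrier := {p | ∀ t : Icc a b,
    HasDerivWithinAt (extendZero (fun s => p.1 s)) (p.2 t) (Icc a b) (t : ℝ)}
  zero_mem' := by
    intro t
    have h : extendZero (fun s : Icc a b => (0 : C(Icc a b, E) × C(Icc a b, E)).1 s)
        = fun _ => (0 : E) := by
      funext s
      by_cases hs : s ∈ Icc a b <;> simp [extendZero]
    rw [h]
    exact hasDerivWithinAt_const _ _ _
  add_mem' := by
    intro p q hp hq t
    have h : extendZero (fun s : Icc a b => (p + q).1 s)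
        = extendZero (fun s => p.1 s) + extendZero (fun s => q.1 s) := by
      funext s
      by_cases hs : s ∈ Icc a b <;> simp [extendZero, hs]
    rw [h]
    exact (hp t).add (hq t)
  smul_mem' := by
    intro c p hp t
    have h : extendZero (fun s : Icc a b => (c • p).1 s)
        = c • extendZero (fun s => p.1 s) := by
      funext s
      by_cases hs : s ∈ Icc a b <;> simp [extendZero, hs]
    rw [h]
    exact (hp t).const_smul c

/-- The value at `t` of a function in `C¹([a, b]; E)` (for `t` in `[a, b]`). -/
def C1Space.eval {a b : ℝ} {E : Type} [NormedAddCommGroup E] [NormedSpace ℝ E]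
    (u : C1Space a b E) (t : ℝ) : E :=
  extendZero (fun s => u.1.1 s) t

/-! ### Assumptions on the system -/

/-- The dynamics are Lipschitz on every product of compact sets. -/
def LipschitzOnCompacts {n m : ℕ} (f : Euc n → Euc m → Euc n) : Prop :=
  ∀ (X : Set (Euc n)) (U : Set (Euc m)), IsCompact X → IsCompact U →
    ∃ C : ℝ, 0 < C ∧ ∀ x₁ ∈ X, ∀ x₂ ∈ X, ∀ u₁ ∈ U, ∀ u₂ ∈ U,
      ‖f x₁ u₁ - f x₂ u₂‖ ≤ C * (‖x₁ - x₂‖ + ‖u₁ - u₂‖)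

/-- Class `K∞` functions on `[0, ∞)`. -/
structure IsClassKInfty (α : ℝ → ℝ) : Prop where
  continuousOn : ContinuousOn α (Ici 0)
  strictMonoOn : StrictMonoOn α (Ici 0)
  map_zero : α 0 = 0
  tendsto : Tendsto α atTop atTop

/-- Strong forward completeness of `dx/dt = f(x, w)`: there is a smooth, positive definite, radially
unbounded function `R` with `∇R(x) · f(x, w) ≤ R(x) + α₃(|w|)`. -/
def StronglyForwardComplete {n m : ℕ} (f : Euc n → Euc m → Euc n) : Prop :=
  ∃ (R : Euc n → ℝ) (α₁ α₂ α₃ : ℝ → ℝ),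
    ContDiff ℝ ∞ R ∧ IsClassKInfty α₁ ∧ IsClassKInfty α₂ ∧ IsClassKInfty α₃ ∧
    (∀ x, α₁ ‖x‖ ≤ R x ∧ R x ≤ α₂ ‖x‖) ∧
    ∀ x w, fderiv ℝ R x (f x w) ≤ R x + α₃ ‖w‖

/-- `x` solves the autonomous equation `x' = g(x)` on `[0, ∞)`. -/
def IsForwardSolution {n : ℕ} (g : Euc n → Euc n) (x : ℝ → Euc n) : Prop :=
  ∀ t, 0 ≤ t → HasDerivWithinAt x (g (x t)) (Ici 0) t

/-- Global asymptotic stability of the origin for `x' = g(x)`: the origin is an equilibrium,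
solutions exist for all positive times, the origin is stable, and it attracts every solution. -/
structure IsGloballyAsymptoticallyStable {n : ℕ} (g : Euc n → Euc n) : Prop where
  equilibrium : g 0 = 0
  complete : ∀ x₀, ∃ x, IsForwardSolution g x ∧ x 0 = x₀
  stable : ∀ ε : ℝ, 0 < ε → ∃ δ : ℝ, 0 < δ ∧ ∀ x, IsForwardSolution g x → ‖x 0‖ < δ →
    ∀ t, 0 ≤ t → ‖x t‖ < ε
  attractive : ∀ x, IsForwardSolution g x → Tendsto x atTop (𝓝 0)

/-! ### The predictor, the sample-horizon flow and the sampling-horizon prediction operator -/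

/-- `P` satisfies `P(s) - ∫_{-D}^s f(P(θ), U(θ)) dθ - X = 0` on `[-D, 0]`. -/
def IsPredictor {n m : ℕ} (f : Euc n → Euc m → Euc n) (D : ℝ) (X : Euc n)
    (U : C1Space (-D) 0 (Euc m)) (P : C1Space (-D) 0 (Euc n)) : Prop :=
  ∀ s ∈ Icc (-D) 0, C1Space.eval P s - (∫ θ in (-D)..s, f (C1Space.eval P θ) (C1Space.eval U θ)) - X = 0

/-- The predictor operator: `predictor f D X U` is the solution of the predictor equation. -/
def predictor {n m : ℕ} (f : Euc n → Euc m → Euc n) (D : ℝ) (X : Euc n)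
    (U : C1Space (-D) 0 (Euc m)) : C1Space (-D) 0 (Euc n) :=
  open Classical in
  if hP : ∃ P, IsPredictor f D X U P then hP.choose else 0

/-- `Z` is in `C¹([0, h))` and satisfies `Z(s) - ∫_0^s f(Z(τ), κ(Z(τ))) dτ - P = 0` there. -/
def IsSampleHorizonFlow {n m : ℕ} (f : Euc n → Euc m → Euc n) (κ : Euc n → Euc m) (h : ℝ)
    (P : Euc n) (Z : ℝ → Euc n) : Prop :=
  ContDiffOn ℝ 1 Z (Ico 0 h) ∧
    ∀ s ∈ Ico 0 h, Z s - (∫ τ in (0 : ℝ)..s, f (Z τ) (κ (Z τ))) - P = 0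

/-- The sample-horizon flow operator (only the values on `[0, h)` are meaningful). -/
def sampleHorizonFlow {n m : ℕ} (f : Euc n → Euc m → Euc n) (κ : Euc n → Euc m) (h : ℝ)
    (P : Euc n) : ℝ → Euc n :=
  open Classical in
  if hZ : ∃ Z, IsSampleHorizonFlow f κ h P Z then hZ.choose else 0

/-- The sampling-horizon prediction operator: the flow started at the final predictor value. -/
def samplingHorizonPrediction {n m : ℕ} (f : Euc n → Euc m → Euc n) (κ : Euc n → Euc m)
    (D h : ℝ) (X : Euc n) (U : C1Space (-D) 0 (Euc m)) : ℝ → Euc n :=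
  sampleHorizonFlow f κ h (C1Space.eval (predictor f D X U) 0)

/-! ### Neural operators -/

/-- Parameters of an ordinary neural network with one hidden layer. -/
structure ShallowNet (ι ο : Type) where
  width : ℕ
  inner : Matrix (Fin width) ι ℝ
  bias : Fin width → ℝ
  outer : Matrix ο (Fin width) ℝ
  offset : ο → ℝ

/-- The network function `z ↦ A σ(B z + c) + d`. -/
def ShallowNet.eval {ι ο : Type} [Fintype ι] (σ : ℝ → ℝ) (N : ShallowNet ι ο) (z : ι → ℝ) :
    ο → ℝ :=
  N.outer *ᵥ (fun i => σ ((N.inner *ᵥ z + N.bias) i)) + N.offset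

/-- Parameters of a hidden layer of an averaging neural operator with `c` channels. -/
structure AveragingLayer (c : ℕ) where
  weight : Matrix (Fin c) (Fin c) ℝ
  bias : Fin c → ℝ

/-- The nonlocal layer `v ↦ σ(W v(x) + b + ⨍ v)` on functions on `[a, b]`. -/
def AveragingLayer.apply {c : ℕ} (σ : ℝ → ℝ) (a b : ℝ) (L : AveragingLayer c)
    (v : ℝ → Fin c → ℝ) (x : ℝ) : Fin c → ℝ :=
  fun i => σ ((L.weight *ᵥ v x + L.bias + ⨍ y in Icc a b, v y) i)

/-- Parameters of an (averaging) neural operator, mapping functions on an interval with values in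
`ℝ^ι` to functions on the same interval with values in `ℝ^ο`. -/
structure NeuralOperator (ι ο : Type) where
  /-- number of channels -/
  channels : ℕ
  /-- lifting network, applied pointwise to `(u(x), x)` -/
  lifting : ShallowNet (ι ⊕ Unit) (Fin channels)
  /-- hidden nonlocal layers, first one first -/
  layers : List (AveragingLayer channels)
  layers_ne_nil : layers ≠ []
  /-- projection network, applied pointwise to `(v(x), x)` -/
  projection : ShallowNet (Fin channels ⊕ Unit) ο

/-- The neural operator `u ↦ Q ∘ L_ℓ ∘ ⋯ ∘ L_1 ∘ R (u)` on functions on `[a, b]`, with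
activation function `σ`. -/
def NeuralOperator.eval {ι ο : Type} [Fintype ι] (σ : ℝ → ℝ) (a b : ℝ) (N : NeuralOperator ι ο)
    (u : ℝ → ι → ℝ) (x : ℝ) : ο → ℝ :=
  let v₀ : ℝ → Fin N.channels → ℝ :=
    fun y => N.lifting.eval σ (Sum.elim (u y) (fun _ => y))
  let v := N.layers.foldl (fun w L => L.apply σ a b w) v₀
  N.projection.eval σ (Sum.elim (v x) (fun _ => x))

/-- The map `(X, U) ↦ N(X, U)(θ)` given by a neural operator on `[-D, 0]`.  Its input function is
`x ↦ (X, U(x))`, the state entering as a constant function, and its output is transported from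
`[-D, 0)` to `[0, h)` by the increasing affine bijection. -/
def NeuralOperator.horizonMap {n m : ℕ} (σ : ℝ → ℝ) (D h : ℝ)
    (N : NeuralOperator (Fin n ⊕ Fin m) (Fin n)) (X : Euc n) (U : C1Space (-D) 0 (Euc m))
    (θ : ℝ) : Euc n :=
  WithLp.toLp 2 (N.eval σ (-D) 0
    (fun x => Sum.elim (fun i => X i) (fun j => C1Space.eval U x j)) (-D + D / h * θ))

end

/-! ### Smooth functions that are not polynomials -/

noncomputable section

/-! Two facts combine: the prediction is a continuous function of `((X, U), x)` on the compact space
`K × [-D, 0]`, and averaging operators with a single hidden layer are uniformly dense among such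
functions.

Continuity. Along solutions `R' ≤ R + α₃(|u|)`, so trajectories with bounded data stay in a ball
depending only on the bounds. There `f` is Lipschitz: Picard–Lindelöf for a cut-off field gives
existence (`exists_isSolutionOn`), and Grönwall gives continuity of the final predictor value
(`continuous_predictor_eval_zero`). Global asymptotic stability includes existence of closed-loop
solutions for all positive times; the resulting flow is jointly continuous in initial value and time
(`continuousOn_flow`).

Density. As `σ` is smooth and not a polynomial, none of its iterated derivatives vanishes
identically. Differentiating `σ(l p + c)` in `l` therefore puts all powers of `p`, hence `exp p`,
into the closed span of neurons, and Stone–Weierstrass applies to the algebra of exponentials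
(`dense_span_activated`). This is used twice: with `p` linear on a compact subset of `ℝ^κ`, giving
ordinary shallow networks, and with `p` a combination of the position and of features `σ(t₀ +
average of a shallow network along the input)`. The features separate inputs because the squared
difference of two distinct inputs has positive integral, which averaged networks detect
(`exists_integral_neuronSum_ne`). One hidden layer computes the features and the projection network
supplies the outer neurons (`exists_neuralOperator_eval_eq`). -/

theorem Polynomial.exists_derivative_eq (p : Polynomial ℝ) :
    ∃ q : Polynomial ℝ, Polynomial.derivative q = p := by
  induction p using Polynomial.induction_on' with
  | add p q hp hq =>
    obtain ⟨p', rfl⟩ := hp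
    obtain ⟨q', rfl⟩ := hq
    exact ⟨p' + q', Polynomial.derivative_add⟩
  | monomial n a =>
    refine ⟨Polynomial.monomial (n + 1) (a / (n + 1)), ?_⟩
    rw [Polynomial.derivative_monomial]
    have : (n : ℝ) + 1 ≠ 0 := by positivity
    simp only [Nat.add_sub_cancel, Nat.cast_add, Nat.cast_one]
    rw [div_mul_cancel₀ _ this]

/-- A smooth function one of whose iterated derivatives vanishes is a polynomial. -/
theorem exists_polynomial_of_iteratedDeriv_eq_zero (k : ℕ) :
    ∀ φ : ℝ → ℝ, ContDiff ℝ ∞ φ → (∀ x, iteratedDeriv k φ x = 0) →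
      ∃ p : Polynomial ℝ, ∀ x, φ x = p.eval x := by
  induction k with
  | zero => exact fun φ _ h => ⟨0, fun x => by simpa using h x⟩
  | succ k ih =>
    intro φ hφ h
    obtain ⟨hd, hφ'⟩ := contDiff_infty_iff_deriv.1 hφ
    obtain ⟨p, hp⟩ := ih (deriv φ) hφ' fun x => by rw [← iteratedDeriv_succ', h x]
    obtain ⟨q, rfl⟩ := p.exists_derivative_eq
    have hconst := is_const_of_deriv_eq_zero (f := fun x => φ x - q.eval x)
      (hd.sub q.differentiable) fun x => by
        rw [deriv_fun_sub (hd x) (q.differentiable x), hp, Polynomial.deriv, sub_self]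
    refine ⟨q + Polynomial.C (φ 0 - q.eval 0), fun x => ?_⟩
    have := hconst x 0
    simp only [Polynomial.eval_add, Polynomial.eval_C]
    linarith

/-! ### Density of the functions `σ ∘ (p + c)` in `C(T, ℝ)` -/

section Approximation

variable {T : Type*} [TopologicalSpace T] [CompactSpace T]

/-- Mean value inequality for `t ↦ φ t - φ' x * t`. The quadratic remainder is uniform on `[-r, r]`,
which is what differentiability in the sup norm requires. -/
theorem abs_sub_sub_le_of_deriv_lipschitz {φ φ' : ℝ → ℝ} {r L : ℝ}
    (hφ : ∀ x, HasDerivAt φ (φ' x) x)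
    (hL : ∀ x ∈ Icc (-r) r, ∀ y ∈ Icc (-r) r, |φ' x - φ' y| ≤ L * |x - y|) (hL0 : 0 ≤ L)
    {x y : ℝ} (hx : x ∈ Icc (-r) r) (hy : y ∈ Icc (-r) r) :
    |φ y - φ x - φ' x * (y - x)| ≤ L * |y - x| * |y - x| := by
  have hsub : uIcc x y ⊆ Icc (-r) r := (convex_Icc _ _).ordConnected.uIcc_subset hx hy
  have := (convex_uIcc x y).norm_image_sub_le_of_norm_hasDerivWithin_le
    (f := fun t => φ t - φ' x * t) (f' := fun t => φ' t - φ' x) (C := L * |y - x|)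
    (fun t _ => by
      simpa using ((hφ t).fun_sub ((hasDerivAt_id t).const_mul (φ' x))).hasDerivWithinAt)
    (fun t ht => by
      rw [Real.norm_eq_abs]
      refine (hL t (hsub ht) x hx).trans (mul_le_mul_of_nonneg_left ?_ hL0)
      exact abs_sub_left_of_mem_uIcc ht)
    left_mem_uIcc right_mem_uIcc
  simp only [Real.norm_eq_abs] at this
  convert this using 2
  ring

/-- Differentiating `l ↦ φ ∘ (l p + q)` inside `C(T, ℝ)`. -/
theorem hasDerivAt_comp_smul_add {φ φ' : C(ℝ, ℝ)} (hφ : ∀ x, HasDerivAt φ (φ' x) x)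
    (hφ' : ContDiff ℝ 1 φ') (p q : C(T, ℝ)) (l : ℝ) :
    HasDerivAt (fun l : ℝ => φ.comp (l • p + q)) (φ'.comp (l • p + q) * p) l := by
  -- All values of `l' • p + q` with `|l' - l| ≤ 1` lie in `[-r, r]`, so one Lipschitz constant of
  -- `φ'` serves every point of `T`.
  set r : ℝ := (|l| + 1) * ‖p‖ + ‖q‖ with hr
  obtain ⟨L, hL⟩ := hφ'.contDiffOn.exists_lipschitzOnWith (s := Icc (-r) r) one_ne_zero
    (convex_Icc _ _) isCompact_Icc
  have hmem : ∀ l' : ℝ, |l' - l| ≤ 1 → ∀ x, (l' • p + q) x ∈ Icc (-r) r := by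
    intro l' hl' x
    rw [mem_Icc, ← abs_le]
    have h1 : |p x| ≤ ‖p‖ := p.norm_coe_le_norm x
    have h2 : |q x| ≤ ‖q‖ := q.norm_coe_le_norm x
    have h3 : |l'| ≤ |l| + 1 := by
      have := abs_sub_abs_le_abs_sub l' l
      linarith
    calc |(l' • p + q) x| = |l' * p x + q x| := by simp
      _ ≤ |l'| * |p x| + |q x| := by rw [← abs_mul]; exact abs_add_le _ _
      _ ≤ r := by rw [hr]; gcongr
  rw [hasDerivAt_iff_isLittleO]
  have hO : (fun l' : ℝ => φ.comp (l' • p + q) - φ.comp (l • p + q)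
      - (l' - l) • (φ'.comp (l • p + q) * p)) =O[𝓝 l] fun l' => (l' - l) ^ 2 := by
    refine Asymptotics.IsBigO.of_bound (L * ‖p‖ ^ 2) ?_
    filter_upwards [Metric.closedBall_mem_nhds l one_pos] with l' hl'
    rw [Metric.mem_closedBall, Real.dist_eq] at hl'
    rw [ContinuousMap.norm_le _ (by positivity)]
    intro x
    have := abs_sub_sub_le_of_deriv_lipschitz (L := (L : ℝ)) hφ
      (fun x hx y hy => by simpa [Real.dist_eq] using hL.dist_le_mul x hx y hy) L.coe_nonneg
      (hmem l (by simp) x) (hmem l' hl' x)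
    have hd : (l' • p + q) x - (l • p + q) x = (l' - l) * p x := by simp; ring
    rw [hd, abs_mul] at this
    simp only [ContinuousMap.sub_apply, ContinuousMap.comp_apply, ContinuousMap.smul_apply,
      ContinuousMap.mul_apply, smul_eq_mul, norm_pow, Real.norm_eq_abs]
    calc _ = |φ ((l' • p + q) x) - φ ((l • p + q) x)
          - φ' ((l • p + q) x) * ((l' - l) * p x)| := by ring_nf
      _ ≤ _ := this
      _ ≤ L * (|l' - l| * ‖p‖) * (|l' - l| * ‖p‖) := by
          have : |p x| ≤ ‖p‖ := p.norm_coe_le_norm x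
          gcongr
      _ = _ := by ring
  refine hO.trans_isLittleO ?_
  have := Asymptotics.isLittleO_pow_id (𝕜 := ℝ) (n := 2) one_lt_two
  exact this.comp_tendsto (tendsto_sub_nhds_zero_iff.2 tendsto_id)

/-- Difference quotients stay in the subspace, and so does their limit. -/
theorem Submodule.mem_of_hasDerivAt {E : Type*} [NormedAddCommGroup E] [NormedSpace ℝ E]
    {M : Submodule ℝ E} (hM : IsClosed (M : Set E)) {F : ℝ → E} {F' : E} {l : ℝ}
    (hF : HasDerivAt F F' l) (hmem : ∀ l, F l ∈ M) : F' ∈ M :=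
  hM.mem_of_tendsto (hasDerivAt_iff_tendsto_slope.1 hF)
    (Eventually.of_forall fun _ => M.smul_mem _ (M.sub_mem (hmem _) (hmem _)))

/-- The function `σ` composed with a continuous function. -/
def activated (σ : C(ℝ, ℝ)) (p : C(T, ℝ)) (c : ℝ) : C(T, ℝ) :=
  σ.comp (p + ContinuousMap.const T c)

theorem contDiff_infty_iteratedDeriv {φ : ℝ → ℝ} (hφ : ContDiff ℝ ∞ φ) (k : ℕ) :
    ContDiff ℝ ∞ (iteratedDeriv k φ) := by
  rw [iteratedDeriv_eq_iterate]
  exact hφ.iterate_deriv k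

/-- Each differentiation in `l` raises the order of the derivative of `σ` by one and brings out one
more factor `p`. -/
theorem pow_mul_comp_iteratedDeriv_mem {M : Submodule ℝ C(T, ℝ)} (hM : IsClosed (M : Set C(T, ℝ)))
    {σ : C(ℝ, ℝ)} (hσ : ContDiff ℝ ∞ σ) (p : C(T, ℝ))
    (hp : ∀ l c : ℝ, activated σ (l • p) c ∈ M) (k : ℕ) (ψ : C(ℝ, ℝ))
    (hψ : ∀ x, ψ x = iteratedDeriv k σ x) (l c : ℝ) :
    activated ψ (l • p) c * p ^ k ∈ M := by
  induction k generalizing ψ l with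
  | zero =>
    have : ψ = σ := by ext x; simp [hψ]
    simpa [this] using hp l c
  | succ k ih =>
    have hk : ContDiff ℝ ∞ (iteratedDeriv k σ) := contDiff_infty_iteratedDeriv hσ k
    let φ : C(ℝ, ℝ) := ⟨iteratedDeriv k σ, hk.continuous⟩
    have hφ : ∀ x, HasDerivAt φ (ψ x) x := fun x => by
      rw [hψ, iteratedDeriv_succ]
      exact (hk.differentiable (by simp) x).hasDerivAt
    have hψ1 : ContDiff ℝ 1 ψ := by
      have : (ψ : ℝ → ℝ) = iteratedDeriv (k + 1) σ := funext hψ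
      rw [this]
      exact (contDiff_infty_iteratedDeriv hσ (k + 1)).of_le (by exact_mod_cast le_top)
    have hd := (hasDerivAt_comp_smul_add hφ hψ1 p (ContinuousMap.const T c) l).mul_const (p ^ k)
    have := Submodule.mem_of_hasDerivAt hM hd fun l => ih φ (fun _ => rfl) l
    rw [mul_assoc, ← pow_succ'] at this
    exact this

/-- At `l = 0` the factor in front of `p ^ k` is the constant `iteratedDeriv k σ c`, which is
nonzero for a suitable `c`. -/
theorem pow_mem_of_activated_mem {M : Submodule ℝ C(T, ℝ)} (hM : IsClosed (M : Set C(T, ℝ)))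
    {σ : C(ℝ, ℝ)} (hσ : ContDiff ℝ ∞ σ)
    (hpoly : ¬ ∃ p : Polynomial ℝ, ∀ x, σ x = p.eval x) (p : C(T, ℝ))
    (hp : ∀ l c : ℝ, activated σ (l • p) c ∈ M) (k : ℕ) : p ^ k ∈ M := by
  obtain ⟨c, hc⟩ : ∃ c, iteratedDeriv k σ c ≠ 0 := by
    by_contra! h
    exact hpoly (exists_polynomial_of_iteratedDeriv_eq_zero k σ hσ h)
  have hk : ContDiff ℝ ∞ (iteratedDeriv k σ) := contDiff_infty_iteratedDeriv hσ k
  have := pow_mul_comp_iteratedDeriv_mem hM hσ p hp k ⟨_, hk.continuous⟩ (fun _ => rfl) 0 c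
  have h2 := M.smul_mem (iteratedDeriv k σ c)⁻¹ this
  convert h2 using 1
  ext x
  simp [activated, hc]

/-- The exponential of a continuous function. -/
def expComp (p : C(T, ℝ)) : C(T, ℝ) := (⟨Real.exp, Real.continuous_exp⟩ : C(ℝ, ℝ)).comp p

/-- The exponential series of `p` converges in the sup norm. -/
theorem expComp_mem_of_pow_mem {M : Submodule ℝ C(T, ℝ)} (hM : IsClosed (M : Set C(T, ℝ)))
    (p : C(T, ℝ)) (hp : ∀ k, p ^ k ∈ M) : expComp p ∈ M := by
  have hs : Summable fun k : ℕ => ((k.factorial : ℝ)⁻¹) • p ^ k := by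
    refine Summable.of_norm_bounded (Real.summable_pow_div_factorial ‖p‖) fun k => ?_
    rw [ContinuousMap.norm_le _ (by positivity)]
    intro x
    have : |p x| ≤ ‖p‖ := p.norm_coe_le_norm x
    have h1 : ‖((k.factorial : ℝ)⁻¹ • p ^ k) x‖ = |p x| ^ k / k.factorial := by
      simp [inv_mul_eq_div]
    rw [h1]
    gcongr
  have heq : expComp p = ∑' k : ℕ, ((k.factorial : ℝ)⁻¹) • p ^ k := by
    ext x
    have h1 := ContinuousMap.hasSum_apply hs.hasSum x
    have h2 := NormedSpace.expSeries_div_hasSum_exp (p x)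
    rw [← Real.exp_eq_exp_ℝ] at h2
    simp only [ContinuousMap.smul_apply, ContinuousMap.pow_apply, smul_eq_mul,
      inv_mul_eq_div] at h1
    exact h2.unique h1
  rw [heq]
  exact hM.mem_of_tendsto hs.hasSum
    (Eventually.of_forall fun s => M.sum_mem fun k _ => M.smul_mem _ (hp k))

/-- Functions `σ ∘ (p + c)`, with `p` in a subspace separating points, span a dense subspace. -/
theorem dense_span_activated {σ : C(ℝ, ℝ)} (hσ : ContDiff ℝ ∞ σ)
    (hpoly : ¬ ∃ p : Polynomial ℝ, ∀ x, σ x = p.eval x) (V : Submodule ℝ C(T, ℝ))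
    (hV : ∀ x y : T, x ≠ y → ∃ p ∈ V, p x ≠ p y) :
    (Submodule.span ℝ (range fun a : V × ℝ => activated σ (a.1 : C(T, ℝ)) a.2)).topologicalClosure
      = ⊤ := by
  set S := Submodule.span ℝ (range fun a : V × ℝ => activated σ (a.1 : C(T, ℝ)) a.2) with hS
  have hcl : IsClosed (S.topologicalClosure : Set C(T, ℝ)) := S.isClosed_topologicalClosure
  have hexp : ∀ p ∈ V, expComp p ∈ S.topologicalClosure := fun p hp =>
    expComp_mem_of_pow_mem hcl p fun k => pow_mem_of_activated_mem hcl hσ hpoly p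
      (fun l c => S.le_topologicalClosure
        (Submodule.subset_span ⟨(⟨l • p, V.smul_mem l hp⟩, c), rfl⟩)) k
  -- Exponentials turn sums in `V` into products, so the algebra they generate is merely their
  -- linear span and stays inside the closure of `S`.
  let N : Submonoid C(T, ℝ) :=
    { carrier := expComp '' V
      one_mem' := ⟨0, V.zero_mem, by ext; simp [expComp]⟩
      mul_mem' := by
        rintro _ _ ⟨p, hp, rfl⟩ ⟨q, hq, rfl⟩
        exact ⟨p + q, V.add_mem hp hq, by ext; simp [expComp, Real.exp_add]⟩ }
  let A : Subalgebra ℝ C(T, ℝ) := Algebra.adjoin ℝ (N : Set C(T, ℝ))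
  have hA : Subalgebra.toSubmodule A ≤ S.topologicalClosure := by
    rw [Algebra.adjoin_eq_span, Submonoid.closure_eq, Submodule.span_le]
    rintro _ ⟨p, hp, rfl⟩
    exact hexp p hp
  have hAtop := ContinuousMap.subalgebra_topologicalClosure_eq_top_of_separatesPoints A <| by
    intro x y hxy
    obtain ⟨p, hp, hne⟩ := hV x y hxy
    exact ⟨_, ⟨expComp p, Algebra.subset_adjoin ⟨p, hp, rfl⟩, rfl⟩,
      fun h => hne (Real.exp_injective h)⟩
  rw [eq_top_iff]
  intro g _
  have hg : g ∈ A.topologicalClosure := by rw [hAtop]; trivial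
  exact closure_minimal (s := (A : Set C(T, ℝ))) (fun _ h => hA h) hcl hg

end Approximation

/-! ### Integral equations and derivatives within an interval -/

section IntegralEquation

variable {E : Type*} [NormedAddCommGroup E] [NormedSpace ℝ E]

theorem hasDerivWithinAt_of_eq_integral [CompleteSpace E] {a b : ℝ} {F x : ℝ → E} {X : E}
    (hF : ContinuousOn F (Icc a b)) (hx : ∀ s ∈ Icc a b, x s = X + ∫ t in a..s, F t)
    {s : ℝ} (hs : s ∈ Icc a b) : HasDerivWithinAt x (F s) (Icc a b) s := by
  have := ODE.hasDerivWithinAt_picard_Icc (f := fun t (_ : E) => F t) (u := univ) (α := fun _ => 0)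
    (left_mem_Icc.2 (hs.1.trans hs.2))
    (hF.comp continuousOn_fst fun p hp => hp.1) continuousOn_const (fun _ _ => mem_univ _) X hs
  exact this.congr (fun t ht => hx t ht) (hx s hs)

theorem eq_integral_of_hasDerivWithinAt [CompleteSpace E] {a b : ℝ} {F x : ℝ → E}
    (hF : ContinuousOn F (Icc a b)) (hx : ∀ s ∈ Icc a b, HasDerivWithinAt x (F s) (Icc a b) s)
    {s : ℝ} (hs : s ∈ Icc a b) : x s = x a + ∫ t in a..s, F t := by
  have hsub : uIcc a s ⊆ Icc a b := by
    rw [uIcc_of_le hs.1]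
    exact Icc_subset_Icc_right hs.2
  exact (ODE.picard_eq_of_hasDerivAt (f := fun t (_ : E) => F t) (u := univ) (α := x)
    (hF.comp continuousOn_fst fun p hp => hsub hp.1)
    (fun t ht => (hx t (hsub ht)).mono hsub) (mapsTo_univ _ _)).symm

theorem HasDerivWithinAt.Ici_of_Icc {a b t : ℝ} {x : ℝ → E} {v : E} (ht : t ∈ Ico a b)
    (h : HasDerivWithinAt x v (Icc a b) t) : HasDerivWithinAt x v (Ici t) t :=
  h.mono_of_mem_nhdsWithin (Icc_mem_nhdsGE_of_mem ht)

end IntegralEquation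

/-! ### Regularity of the dynamics and continuous dependence on the data -/

section Dynamics

variable {n m : ℕ} {f : Euc n → Euc m → Euc n}

/-- `x` solves `x' = f(x, u)` on `[a, b]`. -/
def IsSolutionOn (f : Euc n → Euc m → Euc n) (u : ℝ → Euc m) (a b : ℝ) (x : ℝ → Euc n) : Prop :=
  ∀ t ∈ Icc a b, HasDerivWithinAt x (f (x t) (u t)) (Icc a b) t

theorem IsSolutionOn.continuousOn {u : ℝ → Euc m} {a b : ℝ} {x : ℝ → Euc n}
    (h : IsSolutionOn f u a b x) : ContinuousOn x (Icc a b) :=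
  fun t ht => (h t ht).continuousWithinAt

theorem LipschitzOnCompacts.continuous (hf : LipschitzOnCompacts f) :
    Continuous fun p : Euc n × Euc m => f p.1 p.2 := by
  rw [continuous_iff_continuousAt]
  rintro ⟨x, u⟩
  obtain ⟨C, -, hC⟩ := hf _ _ (isCompact_closedBall x 1) (isCompact_closedBall u 1)
  rw [ContinuousAt, tendsto_iff_norm_sub_tendsto_zero]
  have hlim : Tendsto (fun p : Euc n × Euc m => C * (‖p.1 - x‖ + ‖p.2 - u‖)) (𝓝 (x, u)) (𝓝 0) := by
    have : Continuous fun p : Euc n × Euc m => C * (‖p.1 - x‖ + ‖p.2 - u‖) := by fun_prop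
    simpa using this.tendsto (x, u)
  refine squeeze_zero' (Eventually.of_forall fun _ => norm_nonneg _) ?_ hlim
  filter_upwards [prod_mem_nhds (Metric.closedBall_mem_nhds x one_pos)
    (Metric.closedBall_mem_nhds u one_pos)] with p hp
  exact hC _ hp.1 _ (Metric.mem_closedBall_self zero_le_one) _ hp.2 _
    (Metric.mem_closedBall_self zero_le_one)

theorem LipschitzOnCompacts.exists_ball (hf : LipschitzOnCompacts f) (ρ s : ℝ) :
    ∃ C : ℝ, 0 < C ∧ ∀ x₁ x₂ u₁ u₂, ‖x₁‖ ≤ ρ → ‖x₂‖ ≤ ρ → ‖u₁‖ ≤ s → ‖u₂‖ ≤ s →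
      ‖f x₁ u₁ - f x₂ u₂‖ ≤ C * (‖x₁ - x₂‖ + ‖u₁ - u₂‖) := by
  obtain ⟨C, hC0, hC⟩ := hf _ _ (isCompact_closedBall (0 : Euc n) ρ)
    (isCompact_closedBall (0 : Euc m) s)
  exact ⟨C, hC0, fun x₁ x₂ u₁ u₂ h1 h2 h3 h4 => hC _ (by simpa using h1) _ (by simpa using h2) _
    (by simpa using h3) _ (by simpa using h4)⟩

/-- Continuous dependence of solutions on initial values and inputs. -/
theorem LipschitzOnCompacts.exists_dist_solution_le (hf : LipschitzOnCompacts f) (ρ s : ℝ) :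
    ∃ C : ℝ, ∀ (a b : ℝ) (u₁ u₂ : ℝ → Euc m) (x₁ x₂ : ℝ → Euc n) (η : ℝ),
      IsSolutionOn f u₁ a b x₁ → IsSolutionOn f u₂ a b x₂ →
      (∀ t ∈ Icc a b, ‖x₁ t‖ ≤ ρ) → (∀ t ∈ Icc a b, ‖x₂ t‖ ≤ ρ) →
      (∀ t ∈ Icc a b, ‖u₁ t‖ ≤ s) → (∀ t ∈ Icc a b, ‖u₂ t‖ ≤ s) →
      (∀ t ∈ Icc a b, ‖u₁ t - u₂ t‖ ≤ η) →
      ∀ t ∈ Icc a b, dist (x₁ t) (x₂ t) ≤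
        dist (x₁ a) (x₂ a) * Real.exp (C * (t - a)) + η * (Real.exp (C * (t - a)) - 1) := by
  obtain ⟨C, hC0, hC⟩ := hf.exists_ball ρ s
  refine ⟨C, fun a b u₁ u₂ x₁ x₂ η h1 h2 hx1 hx2 hu1 hu2 hu t ht => ?_⟩
  have hI : Ico a b ⊆ Icc a b := Ico_subset_Icc_self
  -- `x₂` solves the equation driven by `u₁` up to an error `C * η`; the quotient `C * η / C` in
  -- Grönwall's bound then leaves `η`.
  have := dist_le_of_approx_trajectories_ODE_of_mem (v := fun t x => f x (u₁ t))
    (s := fun _ => {x | ‖x‖ ≤ ρ}) (K := C.toNNReal) (εf := 0) (εg := C * η)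
    (fun t ht => LipschitzOnWith.of_dist_le_mul fun x hx y hy => by
      rw [dist_eq_norm, dist_eq_norm, Real.coe_toNNReal _ hC0.le]
      simpa using hC x y (u₁ t) (u₁ t) hx hy (hu1 t (hI ht)) (hu1 t (hI ht)))
    h1.continuousOn (fun t ht => (h1 t (hI ht)).Ici_of_Icc ht) (fun t _ => (dist_self _).le)
    (fun t ht => hx1 t (hI ht))
    h2.continuousOn (fun t ht => (h2 t (hI ht)).Ici_of_Icc ht)
    (fun t ht => by
      have ht := hI ht
      rw [dist_eq_norm]
      refine (hC _ _ _ _ (hx2 t ht) (hx2 t ht) (hu2 t ht) (hu1 t ht)).trans ?_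
      rw [sub_self, norm_zero, zero_add, norm_sub_rev]
      exact mul_le_mul_of_nonneg_left (hu t ht) hC0.le)
    (fun t ht => hx2 t (hI ht)) le_rfl t ht
  rw [Real.coe_toNNReal _ hC0.le, zero_add, gronwallBound_of_K_ne_0 hC0.ne'] at this
  rwa [mul_div_cancel_left₀ _ hC0.ne'] at this

/-! ### Bounds from strong forward completeness -/

theorem IsClassKInfty.exists_bound {α : ℝ → ℝ} (hα : IsClassKInfty α) (B : ℝ) :
    ∃ ρ : ℝ, 0 < ρ ∧ ∀ r, α r ≤ B → r ≤ ρ := by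
  obtain ⟨ρ, hρ⟩ := (hα.tendsto.eventually_gt_atTop B).exists_forall_of_atTop
  refine ⟨max ρ 1, by positivity, fun r hr => ?_⟩
  by_contra! h
  exact absurd hr (not_le.2 (hρ r ((le_max_left _ _).trans h.le)))

theorem IsClassKInfty.nonneg {α : ℝ → ℝ} (hα : IsClassKInfty α) {r : ℝ} (hr : 0 ≤ r) :
    0 ≤ α r := by
  rw [← hα.map_zero]
  exact hα.strictMonoOn.monotoneOn self_mem_Ici hr hr

/-- A differential inequality `V' ≤ V + c` gives exponential growth at most. -/
theorem add_le_mul_exp_of_deriv_le {a b c : ℝ} {V V' : ℝ → ℝ}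
    (hV : ∀ t ∈ Icc a b, HasDerivWithinAt V (V' t) (Icc a b) t)
    (hle : ∀ t ∈ Icc a b, V' t ≤ V t + c) {t : ℝ} (ht : t ∈ Icc a b) :
    V t + c ≤ (V a + c) * Real.exp (t - a) := by
  -- Integrating factor: the assumed inequality makes this derivative nonpositive.
  have hd : ∀ s ∈ Icc a b, HasDerivWithinAt (fun s => (V s + c) * Real.exp (a - s))
      ((V' s - (V s + c)) * Real.exp (a - s)) (Icc a b) s := fun s hs => by
    have h1 := ((hV s hs).add_const c).mul
      (((hasDerivAt_id s).const_sub a).exp).hasDerivWithinAt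
    exact h1.congr_deriv (by simp only [id_eq]; ring)
  have hanti : AntitoneOn (fun s => (V s + c) * Real.exp (a - s)) (Icc a b) := by
    refine antitoneOn_of_hasDerivWithinAt_nonpos (convex_Icc a b)
      (fun s hs => (hd s hs).continuousWithinAt)
      (fun s hs => (hd s (interior_subset hs)).mono interior_subset) fun s hs => ?_
    exact mul_nonpos_of_nonpos_of_nonneg (by linarith [hle s (interior_subset hs)])
      (Real.exp_pos _).le
  have := hanti (left_mem_Icc.2 (ht.1.trans ht.2)) ht ht.1
  simp only [sub_self, Real.exp_zero, mul_one] at this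
  calc V t + c = (V t + c) * Real.exp (a - t) * Real.exp (t - a) := by
        rw [mul_assoc, ← Real.exp_add]; simp
    _ ≤ _ := mul_le_mul_of_nonneg_right this (Real.exp_pos _).le

/-- Bounded inputs and bounded initial values give bounded trajectories, uniformly over all
slowed down versions of the dynamics. -/
theorem StronglyForwardComplete.exists_bound (hfc : StronglyForwardComplete f) (T r s : ℝ) :
    ∃ ρ : ℝ, 0 < ρ ∧ ∀ (a b : ℝ) (u : ℝ → Euc m) (χ : Euc n → ℝ) (x : ℝ → Euc n), b - a ≤ T →
      (∀ z, 0 ≤ χ z ∧ χ z ≤ 1) → IsSolutionOn (fun z w => χ z • f z w) u a b x →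
      ‖x a‖ ≤ r → (∀ t ∈ Icc a b, ‖u t‖ ≤ s) → ∀ t ∈ Icc a b, ‖x t‖ ≤ ρ := by
  obtain ⟨R, α₁, α₂, α₃, hR, h1, h2, h3, hα, hRf⟩ := hfc
  obtain ⟨ρ, hρ0, hρ⟩ := h1.exists_bound ((α₂ r + α₃ s) * Real.exp T)
  refine ⟨ρ, hρ0, fun a b u χ x hab hχ hx hxa hu t ht => hρ _ ?_⟩
  have hR0 : ∀ z, 0 ≤ R z := fun z => (h1.nonneg (norm_nonneg z)).trans (hα z).1
  have hr : 0 ≤ r := (norm_nonneg _).trans hxa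
  have hs : 0 ≤ s := (norm_nonneg _).trans (hu t ht)
  have hs3 := h3.nonneg hs
  have hgrow := add_le_mul_exp_of_deriv_le (c := α₃ s) (V := fun t => R (x t))
    (V' := fun t => fderiv ℝ R (x t) (χ (x t) • f (x t) (u t)))
    (fun τ hτ => ((hR.differentiable (by simp)) (x τ)).hasFDerivAt.comp_hasDerivWithinAt τ (hx τ hτ))
    (fun τ hτ => by
      have h4 : α₃ ‖u τ‖ ≤ α₃ s := h3.strictMonoOn.monotoneOn (norm_nonneg _) hs (hu τ hτ)
      have h5 := hRf (x τ) (u τ)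
      have h6 := hR0 (x τ)
      have h7 := hχ (x τ)
      -- The upper bound `R + α₃ s` is nonnegative, so multiplying the derivative by a factor in
      -- `[0, 1]` preserves the inequality.
      rw [map_smul, smul_eq_mul]
      nlinarith) ht
  have h8 : R (x a) ≤ α₂ r := (hα _).2.trans
    (h2.strictMonoOn.monotoneOn (norm_nonneg _) hr hxa)
  calc α₁ ‖x t‖ ≤ R (x t) := (hα _).1
    _ ≤ R (x t) + α₃ s := by linarith
    _ ≤ (R (x a) + α₃ s) * Real.exp (t - a) := hgrow
    _ ≤ (α₂ r + α₃ s) * Real.exp T := by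
        have := h2.nonneg hr
        have : t - a ≤ T := by linarith [ht.2]
        gcongr

theorem StronglyForwardComplete.exists_bound_solution (hfc : StronglyForwardComplete f)
    (T r s : ℝ) :
    ∃ ρ : ℝ, ∀ (a b : ℝ) (u : ℝ → Euc m) (x : ℝ → Euc n), b - a ≤ T →
      IsSolutionOn f u a b x → ‖x a‖ ≤ r → (∀ t ∈ Icc a b, ‖u t‖ ≤ s) →
      ∀ t ∈ Icc a b, ‖x t‖ ≤ ρ := by
  obtain ⟨ρ, -, hρ⟩ := hfc.exists_bound T r s
  refine ⟨ρ, fun a b u x hab hx => hρ a b u (fun _ => 1) x hab (fun _ => by simp) ?_⟩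
  simpa using hx

/-- A cutoff function equal to one on the ball of radius `ρ`. -/
def radialCutoff (ρ : ℝ) (z : Euc n) : ℝ := max 0 (min 1 (ρ + 1 - ‖z‖))

theorem radialCutoff_mem (ρ : ℝ) (z : Euc n) : 0 ≤ radialCutoff ρ z ∧ radialCutoff ρ z ≤ 1 :=
  ⟨le_max_left _ _, max_le zero_le_one (min_le_left _ _)⟩

theorem radialCutoff_eq_one {ρ : ℝ} {z : Euc n} (hz : ‖z‖ ≤ ρ) : radialCutoff ρ z = 1 := by
  rw [radialCutoff, min_eq_left (by linarith), max_eq_right zero_le_one]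

theorem radialCutoff_eq_zero {ρ : ℝ} {z : Euc n} (hz : ρ + 1 ≤ ‖z‖) : radialCutoff ρ z = 0 := by
  rw [radialCutoff, max_eq_left]
  exact (min_le_right _ _).trans (by linarith)

theorem abs_radialCutoff_sub_le (ρ : ℝ) (z w : Euc n) :
    |radialCutoff ρ z - radialCutoff ρ w| ≤ ‖z - w‖ := by
  calc |radialCutoff ρ z - radialCutoff ρ w| ≤ |min 1 (ρ + 1 - ‖z‖) - min 1 (ρ + 1 - ‖w‖)| := by
        simp only [radialCutoff, max_comm (0 : ℝ)]
        exact abs_max_sub_max_le_abs _ _ _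
    _ ≤ |(ρ + 1 - ‖z‖) - (ρ + 1 - ‖w‖)| := by
        refine (abs_min_sub_min_le_max _ _ _ _).trans ?_
        simp
    _ = |‖w‖ - ‖z‖| := by ring_nf
    _ ≤ ‖z - w‖ := by rw [norm_sub_rev]; exact abs_norm_sub_norm_le w z

/-- Solutions for bounded continuous inputs exist on every compact interval. -/
theorem exists_isSolutionOn (hf : LipschitzOnCompacts f) (hfc : StronglyForwardComplete f)
    {a b : ℝ} (hab : a ≤ b) {u : ℝ → Euc m} (hu : ContinuousOn u (Icc a b)) (X : Euc n) :
    ∃ x, x a = X ∧ IsSolutionOn f u a b x := by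
  obtain ⟨s, hs⟩ := isCompact_Icc.exists_bound_of_continuousOn hu
  -- The radius is chosen before the cutoff: the bound covers all slowed down dynamics, hence also
  -- the field cut off at this very radius.
  obtain ⟨ρ, -, hρ⟩ := hfc.exists_bound (b - a) ‖X‖ s
  set F : ℝ → Euc n → Euc n := fun t z => radialCutoff ρ z • f z (u t) with hF
  have hcont := hf.continuous
  obtain ⟨L, hL⟩ := ((isCompact_closedBall (0 : Euc n) (ρ + 1)).prod
    (isCompact_closedBall (0 : Euc m) s)).exists_bound_of_continuousOn hcont.continuousOn
  have hL' : ∀ t ∈ Icc a b, ∀ z, ‖F t z‖ ≤ max L 0 := by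
    intro t ht z
    rcases le_total ‖z‖ (ρ + 1) with hz | hz
    · have h1 := hL (z, u t) ⟨by simpa using hz, by simpa using hs t ht⟩
      rw [hF, norm_smul, Real.norm_of_nonneg (radialCutoff_mem ρ z).1]
      calc _ ≤ 1 * ‖f z (u t)‖ :=
            mul_le_mul_of_nonneg_right (radialCutoff_mem ρ z).2 (norm_nonneg _)
        _ ≤ _ := by rw [one_mul]; exact h1.trans (le_max_left _ _)
    · simp [hF, radialCutoff_eq_zero hz]
  -- With speed at most `max L 0`, a trajectory cannot leave the ball of radius `A` around `X`
  -- before time `b`, so Picard–Lindelöf covers the whole interval.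
  set A : ℝ := max L 0 * (b - a) with hA
  have hA0 : 0 ≤ A := mul_nonneg (le_max_right _ _) (by linarith)
  obtain ⟨C, hC0, hC⟩ := hf.exists_ball (‖X‖ + A) s
  obtain ⟨B, hB⟩ := ((isCompact_closedBall (0 : Euc n) (‖X‖ + A)).prod
    (isCompact_closedBall (0 : Euc m) s)).exists_bound_of_continuousOn hcont.continuousOn
  have hball : ∀ z ∈ Metric.closedBall X A, ‖z‖ ≤ ‖X‖ + A := fun z hz => by
    rw [mem_closedBall_iff_norm] at hz
    calc ‖z‖ = ‖X + (z - X)‖ := by congr 1; abel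
      _ ≤ _ := (norm_add_le _ _).trans (by gcongr)
  have hpl : IsPicardLindelof F (⟨a, left_mem_Icc.2 hab⟩ : Icc a b) X ⟨A, hA0⟩ 0
      ⟨max L 0, le_max_right _ _⟩ (C + B).toNNReal := by
    refine ⟨fun t ht => LipschitzOnWith.of_dist_le_mul fun z hz w hw => ?_, fun z hz => ?_,
      fun t ht z _ => hL' t ht z, ?_⟩
    · have hz' := hball z hz
      have hw' := hball w hw
      have hus := hs t ht
      have h1 := hC z w (u t) (u t) hz' hw' hus hus
      rw [sub_self, norm_zero, add_zero] at h1
      have h2 := hB (w, u t) ⟨by simpa using hw', by simpa using hus⟩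
      have h3 := abs_radialCutoff_sub_le ρ z w
      have h4 := radialCutoff_mem ρ z
      rw [dist_eq_norm, dist_eq_norm]
      have h5 : F t z - F t w = radialCutoff ρ z • (f z (u t) - f w (u t))
          + (radialCutoff ρ z - radialCutoff ρ w) • f w (u t) := by
        simp only [hF]
        module
      calc ‖F t z - F t w‖ ≤ radialCutoff ρ z * ‖f z (u t) - f w (u t)‖
            + |radialCutoff ρ z - radialCutoff ρ w| * ‖f w (u t)‖ := by
            rw [h5]
            refine (norm_add_le _ _).trans ?_
            rw [norm_smul, norm_smul, Real.norm_of_nonneg h4.1, Real.norm_eq_abs]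
        _ ≤ 1 * (C * ‖z - w‖) + ‖z - w‖ * B := by
            have := h4.2
            have := norm_nonneg (z - w)
            gcongr
        _ = (C + B) * ‖z - w‖ := by ring
        _ ≤ _ := by gcongr; exact Real.le_coe_toNNReal _
    · exact (hcont.comp_continuousOn (continuousOn_const.prodMk hu)).const_smul (radialCutoff ρ z)
    · simp only [sub_self, NNReal.coe_zero, sub_zero, sub_nonneg.2 hab, max_eq_left]
      exact le_rfl
  obtain ⟨x, hxa, hx⟩ := hpl.exists_eq_forall_mem_Icc_hasDerivWithinAt₀
  refine ⟨x, hxa, fun t ht => ?_⟩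
  -- The cutoff is therefore one along `x`, which solves the original equation.
  have hbound := hρ a b u (radialCutoff ρ) x le_rfl (radialCutoff_mem ρ) hx
    (by rw [← hxa]) hs t ht
  have := hx t ht
  simp only [hF, radialCutoff_eq_one hbound, one_smul] at this
  exact this

/-! ### Elements of `C¹([a, b])` -/

theorem extendZero_apply {a b t : ℝ} {E : Type} [Zero E] (u : Icc a b → E) (ht : t ∈ Icc a b) :
    extendZero u t = u ⟨t, ht⟩ := dif_pos ht

namespace C1Space

variable {a b : ℝ} {E : Type} [NormedAddCommGroup E] [NormedSpace ℝ E]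

theorem eval_apply (u : C1Space a b E) {t : ℝ} (ht : t ∈ Icc a b) : C1Space.eval u t = u.1.1 ⟨t, ht⟩ :=
  extendZero_apply _ ht

theorem continuousOn_eval (u : C1Space a b E) : ContinuousOn (C1Space.eval u) (Icc a b) :=
  fun t ht => (u.2 ⟨t, ht⟩).continuousWithinAt

theorem norm_eval_sub_le (u v : C1Space a b E) {t : ℝ} (ht : t ∈ Icc a b) :
    ‖C1Space.eval u t - C1Space.eval v t‖ ≤ ‖u - v‖ := by
  rw [eval_apply u ht, eval_apply v ht]
  calc _ = ‖(u.1.1 - v.1.1) ⟨t, ht⟩‖ := rfl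
    _ ≤ ‖u.1.1 - v.1.1‖ := ContinuousMap.norm_coe_le_norm _ _
    _ ≤ _ := norm_fst_le (u - v).1

theorem norm_eval_sub_le_dist (u v : C1Space a b E) {t : ℝ} (ht : t ∈ Icc a b) :
    ‖C1Space.eval u t - C1Space.eval v t‖ ≤ dist u v :=
  (norm_eval_sub_le u v ht).trans_eq (dist_eq_norm u v).symm

theorem eval_zero {t : ℝ} (ht : t ∈ Icc a b) : C1Space.eval (0 : C1Space a b E) t = 0 := by
  rw [eval_apply _ ht]; rfl

theorem norm_eval_le (u : C1Space a b E) {t : ℝ} (ht : t ∈ Icc a b) : ‖C1Space.eval u t‖ ≤ ‖u‖ := by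
  simpa [eval_zero ht] using norm_eval_sub_le u 0 ht

theorem exists_eval_eq {x F : ℝ → E} (hF : ContinuousOn F (Icc a b))
    (hx : ∀ t ∈ Icc a b, HasDerivWithinAt x (F t) (Icc a b) t) :
    ∃ u : C1Space a b E, ∀ t ∈ Icc a b, C1Space.eval u t = x t := by
  have hxc : ContinuousOn x (Icc a b) := fun t ht => (hx t ht).continuousWithinAt
  refine ⟨⟨(⟨_, hxc.domRestrict⟩, ⟨_, hF.domRestrict⟩), fun t => ?_⟩, fun t ht => ?_⟩
  · exact (hx t t.2).congr (fun s hs => extendZero_apply _ hs) (extendZero_apply _ t.2)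
  · rw [eval_apply _ ht]; rfl

/-- The derivative component is determined by the values because derivatives within a nondegenerate
interval are unique; this is the role of `a < b`. -/
theorem ext_eval {u v : C1Space a b E} (hab : a < b) (h : ∀ t ∈ Icc a b, C1Space.eval u t = C1Space.eval v t) :
    u = v := by
  have h1 : u.1.1 = v.1.1 := by
    ext t
    rw [← eval_apply u t.2, ← eval_apply v t.2, h t t.2]
  refine Subtype.ext (Prod.ext h1 ?_)
  ext t
  have h2 := v.2 t
  rw [← h1] at h2
  exact ((uniqueDiffOn_Icc hab) t t.2).eq_deriv _ (u.2 t) h2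

end C1Space

/-! ### The predictor -/

theorem continuousOn_dynamics (hf : LipschitzOnCompacts f) {s : Set ℝ} {x : ℝ → Euc n}
    {u : ℝ → Euc m} (hx : ContinuousOn x s) (hu : ContinuousOn u s) :
    ContinuousOn (fun t => f (x t) (u t)) s :=
  hf.continuous.comp_continuousOn (hx.prodMk hu)

theorem IsPredictor.isSolutionOn (hf : LipschitzOnCompacts f) {D : ℝ} {X : Euc n}
    {U : C1Space (-D) 0 (Euc m)} {P : C1Space (-D) 0 (Euc n)} (h : IsPredictor f D X U P) :
    IsSolutionOn f (C1Space.eval U) (-D) 0 (C1Space.eval P) := fun t ht =>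
  hasDerivWithinAt_of_eq_integral (X := X)
    (continuousOn_dynamics hf (C1Space.continuousOn_eval P) (C1Space.continuousOn_eval U))
    (fun s hs => by
      have := h s hs
      rw [sub_sub, sub_eq_zero] at this
      rw [this, add_comm]) ht

theorem IsPredictor.eval_left {D : ℝ} (hD : 0 ≤ D) {X : Euc n}
    {U : C1Space (-D) 0 (Euc m)} {P : C1Space (-D) 0 (Euc n)} (h : IsPredictor f D X U P) :
    C1Space.eval P (-D) = X := by
  simpa [sub_eq_zero] using h (-D) (left_mem_Icc.2 (by linarith))

theorem isPredictor_predictor (hf : LipschitzOnCompacts f) (hfc : StronglyForwardComplete f)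
    {D : ℝ} (hD : 0 ≤ D) (X : Euc n) (U : C1Space (-D) 0 (Euc m)) :
    IsPredictor f D X U (predictor f D X U) := by
  have hex : ∃ P, IsPredictor f D X U P := by
    obtain ⟨x, hxa, hx⟩ := exists_isSolutionOn hf hfc (by linarith : -D ≤ 0)
      (C1Space.continuousOn_eval U) X
    have hF := continuousOn_dynamics hf hx.continuousOn (C1Space.continuousOn_eval U)
    obtain ⟨P, hP⟩ := C1Space.exists_eval_eq hF hx
    refine ⟨P, fun s hs => ?_⟩
    have hint : ∫ θ in (-D)..s, f (C1Space.eval P θ) (C1Space.eval U θ) = ∫ θ in (-D)..s, f (x θ) (C1Space.eval U θ) := by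
      refine intervalIntegral.integral_congr fun θ hθ => ?_
      rw [uIcc_of_le hs.1] at hθ
      simp only [hP θ ⟨hθ.1, hθ.2.trans hs.2⟩]
    rw [hint, hP s hs, eq_integral_of_hasDerivWithinAt hF hx hs, hxa]
    abel
  rw [predictor, dif_pos hex]
  exact hex.choose_spec

theorem tendsto_dist_mul_add_dist_mul {α β : Type*} [PseudoMetricSpace α] [PseudoMetricSpace β]
    (x : α) (y : β) (c d : ℝ) :
    Tendsto (fun p : α × β => dist p.1 x * c + dist p.2 y * d) (𝓝 (x, y)) (𝓝 0) := by
  have : Continuous fun p : α × β => dist p.1 x * c + dist p.2 y * d := by fun_prop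
  simpa using this.tendsto (x, y)

/-- Data within distance one of `(X, U)` share one a priori bound `ρ`, hence one Grönwall constant.
-/
theorem continuous_predictor_eval_zero (hf : LipschitzOnCompacts f)
    (hfc : StronglyForwardComplete f) {D : ℝ} (hD : 0 ≤ D) :
    Continuous fun p : Euc n × C1Space (-D) 0 (Euc m) => C1Space.eval (predictor f D p.1 p.2) 0 := by
  rw [continuous_iff_continuousAt]
  rintro ⟨X, U⟩
  obtain ⟨ρ, hρ⟩ := hfc.exists_bound_solution D (‖X‖ + 1) (‖U‖ + 1)
  obtain ⟨C, hC⟩ := hf.exists_dist_solution_le ρ (‖U‖ + 1)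
  rw [ContinuousAt, tendsto_iff_dist_tendsto_zero]
  have hlim := tendsto_dist_mul_add_dist_mul X U (Real.exp (C * D)) (Real.exp (C * D) - 1)
  refine squeeze_zero' (Eventually.of_forall fun _ => dist_nonneg) ?_ hlim
  have key : ∀ Y W, ‖Y‖ ≤ ‖X‖ + 1 → ‖W‖ ≤ ‖U‖ + 1 →
      IsSolutionOn f (C1Space.eval W) (-D) 0 (C1Space.eval (predictor f D Y W)) ∧
      C1Space.eval (predictor f D Y W) (-D) = Y ∧ (∀ t ∈ Icc (-D) 0, ‖C1Space.eval W t‖ ≤ ‖U‖ + 1) ∧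
      ∀ t ∈ Icc (-D) 0, ‖C1Space.eval (predictor f D Y W) t‖ ≤ ρ := by
    intro Y W hY hW
    have hp := isPredictor_predictor hf hfc hD Y W
    have hW' : ∀ t ∈ Icc (-D) 0, ‖C1Space.eval W t‖ ≤ ‖U‖ + 1 := fun t ht => ((C1Space.norm_eval_le W ht)).trans hW
    exact ⟨hp.isSolutionOn hf, hp.eval_left hD, hW', hρ _ _ _ _ (by linarith)
      (hp.isSolutionOn hf) (by rw [hp.eval_left hD]; exact hY) hW'⟩
  obtain ⟨h1, h2, h3, h4⟩ := key X U (by linarith) (by linarith)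
  filter_upwards [prod_mem_nhds (Metric.closedBall_mem_nhds X one_pos)
    (Metric.closedBall_mem_nhds U one_pos)] with p hp
  have hY : ‖p.1‖ ≤ ‖X‖ + 1 := norm_le_norm_add_const_of_dist_le hp.1
  have hW : ‖p.2‖ ≤ ‖U‖ + 1 := norm_le_norm_add_const_of_dist_le hp.2
  obtain ⟨k1, k2, k3, k4⟩ := key p.1 p.2 hY hW
  have := hC _ _ _ _ _ _ _ k1 h1 k4 h4 k3 h3 (fun t ht => C1Space.norm_eval_sub_le_dist p.2 U ht) 0
    (right_mem_Icc.2 (by linarith))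
  rw [k2, h2, sub_neg_eq_add, zero_add] at this
  exact this

/-! ### The closed-loop flow -/

/-- `x` solves `x' = g(x)` on `[0, b]`. -/
def IsFlowOn (g : Euc n → Euc n) (b : ℝ) (x : ℝ → Euc n) : Prop :=
  ∀ t ∈ Icc 0 b, HasDerivWithinAt x (g (x t)) (Icc 0 b) t

theorem IsFlowOn.continuousOn {g : Euc n → Euc n} {b : ℝ} {x : ℝ → Euc n} (h : IsFlowOn g b x) :
    ContinuousOn x (Icc 0 b) := fun t ht => (h t ht).continuousWithinAt

theorem IsFlowOn.mono {g : Euc n → Euc n} {b c : ℝ} {x : ℝ → Euc n} (h : IsFlowOn g b x)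
    (hcb : c ≤ b) : IsFlowOn g c x := fun t ht =>
  (h t ⟨ht.1, ht.2.trans hcb⟩).mono (Icc_subset_Icc_right hcb)

theorem IsForwardSolution.isFlowOn {g : Euc n → Euc n} {x : ℝ → Euc n}
    (h : IsForwardSolution g x) (b : ℝ) : IsFlowOn g b x := fun t ht =>
  (h t ht.1).mono Icc_subset_Ici_self

/-- Solutions starting sufficiently close to a given one remain close. -/
theorem IsFlowOn.dist_le {g : Euc n → Euc n} {b ρ : ℝ} {K : NNReal} {x y : ℝ → Euc n}
    (hx : IsFlowOn g b x) (hy : IsFlowOn g b y) (hρ : ∀ t ∈ Icc 0 b, ‖x t‖ ≤ ρ)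
    (hK : LipschitzOnWith K g (Metric.closedBall 0 (ρ + 1)))
    (h0 : dist (y 0) (x 0) * Real.exp (K * b) < 1) :
    ∀ t ∈ Icc 0 b, dist (y t) (x t) ≤ dist (y 0) (x 0) * Real.exp (K * b) := by
  -- Bootstrap: while the distance is below one, `y` stays in the ball where `g` is `K`-Lipschitz,
  -- and Grönwall gives a bound that is itself below one.
  have hgron : ∀ c ≤ b, (∀ t ∈ Ico 0 c, dist (y t) (x t) < 1) → ∀ t ∈ Icc 0 c,
      dist (y t) (x t) ≤ dist (y 0) (x 0) * Real.exp (K * b) := by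
    intro c hc hlt t ht
    have hxc := hx.mono hc
    have hyc := hy.mono hc
    have hI : Ico 0 c ⊆ Icc 0 c := Ico_subset_Icc_self
    have hxb : ∀ t ∈ Ico 0 c, ‖x t‖ ≤ ρ := fun t ht => hρ t ⟨ht.1, ht.2.le.trans hc⟩
    have := dist_le_of_trajectories_ODE_of_mem (v := fun _ => g) (K := K)
      (s := fun _ => Metric.closedBall 0 (ρ + 1)) (fun _ _ => hK) hyc.continuousOn
      (fun t ht => (hyc t (hI ht)).Ici_of_Icc ht)
      (fun t ht => by
        rw [mem_closedBall_zero_iff]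
        exact (norm_le_norm_add_const_of_dist_le (hlt t ht).le).trans (by linarith [hxb t ht]))
      hxc.continuousOn (fun t ht => (hxc t (hI ht)).Ici_of_Icc ht)
      (fun t ht => by
        rw [mem_closedBall_zero_iff]
        linarith [hxb t ht])
      le_rfl t ht
    refine this.trans ?_
    have : t - 0 ≤ b := by linarith [ht.2]
    gcongr
  refine hgron b le_rfl fun t ht => ?_
  by_contra! hge
  have hcont : ContinuousOn (fun t => dist (y t) (x t)) (Icc 0 b) :=
    continuous_dist.comp_continuousOn (hy.continuousOn.prodMk hx.continuousOn)
  have hclosed : IsClosed (Icc 0 b ∩ (fun t => dist (y t) (x t)) ⁻¹' Ici 1) :=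
    hcont.preimage_isClosed_of_isClosed isClosed_Icc isClosed_Ici
  -- The first time at which the distance reaches one contradicts the bootstrap on `[0, c]`.
  obtain ⟨c, hc, hmin⟩ := (isCompact_Icc.of_isClosed_subset hclosed
    inter_subset_left).exists_isLeast ⟨t, Ico_subset_Icc_self ht, hge⟩
  have hlt := hgron c hc.1.2 (fun s hs => by
    by_contra! hs1
    exact absurd (hmin ⟨⟨hs.1, hs.2.le.trans hc.1.2⟩, hs1⟩) (not_le.2 hs.2)) c
    (right_mem_Icc.2 hc.1.1)
  have hc1 : 1 ≤ dist (y c) (x c) := hc.2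
  linarith

section Flow

variable {g : Euc n → Euc n}

theorem continuous_of_lipschitzOnWith_balls
    (hg : ∀ ρ, ∃ K, LipschitzOnWith K g (Metric.closedBall 0 ρ)) : Continuous g := by
  rw [continuous_iff_continuousAt]
  intro x
  obtain ⟨K, hK⟩ := hg (‖x‖ + 1)
  refine hK.continuousOn.continuousAt (Filter.mem_of_superset (Metric.ball_mem_nhds x one_pos) ?_)
  intro y hy
  rw [mem_closedBall_zero_iff]
  exact norm_le_norm_add_const_of_dist_le (Metric.mem_ball.1 hy).le

theorem IsFlowOn.eqOn
    (hg : ∀ ρ, ∃ K, LipschitzOnWith K g (Metric.closedBall 0 ρ))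
    {b : ℝ} {x y : ℝ → Euc n} (hx : IsFlowOn g b x) (hy : IsFlowOn g b y)
    (h0 : y 0 = x 0) : EqOn y x (Icc 0 b) := fun t ht => by
  obtain ⟨ρ, hρ⟩ := isCompact_Icc.exists_bound_of_continuousOn hx.continuousOn
  obtain ⟨K, hK⟩ := hg (ρ + 1)
  have := hx.dist_le hy hρ hK (by simp [h0]) t ht
  rw [h0, dist_self, zero_mul] at this
  exact dist_le_zero.1 this

/-- Triangle inequality through the trajectory from `P` at the perturbed time: the change of initial
value is controlled uniformly in time, the change of time by continuity of a single trajectory. -/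
theorem continuousOn_flow
    (hg : ∀ ρ, ∃ K, LipschitzOnWith K g (Metric.closedBall 0 ρ))
    {b : ℝ} (Φ : Euc n → ℝ → Euc n) (hΦ : ∀ P, IsFlowOn g b (Φ P))
    (hΦ0 : ∀ P, Φ P 0 = P) :
    ContinuousOn (fun p : Euc n × ℝ => Φ p.1 p.2) (univ ×ˢ Icc 0 b) := by
  rintro ⟨P, t⟩ ⟨-, ht⟩
  obtain ⟨ρ, hρ⟩ := isCompact_Icc.exists_bound_of_continuousOn (hΦ P).continuousOn
  obtain ⟨K, hK⟩ := hg (ρ + 1)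
  have hclose : Tendsto (fun p : Euc n × ℝ => dist p.1 P * Real.exp (K * b))
      (𝓝[univ ×ˢ Icc 0 b] (P, t)) (𝓝 0) := by
    have : Continuous fun p : Euc n × ℝ => dist p.1 P * Real.exp (K * b) := by fun_prop
    simpa using (this.tendsto (P, t)).mono_left nhdsWithin_le_nhds
  have hP : Tendsto (fun p : Euc n × ℝ => Φ P p.2) (𝓝[univ ×ˢ Icc 0 b] (P, t)) (𝓝 (Φ P t)) := by
    refine Tendsto.comp ((hΦ P).continuousOn t ht) ?_
    exact tendsto_nhdsWithin_iff.2 ⟨continuous_snd.continuousWithinAt,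
      eventually_nhdsWithin_of_forall fun p hp => hp.2⟩
  have hdiff : Tendsto (fun p : Euc n × ℝ => dist (Φ p.1 p.2) (Φ P p.2))
      (𝓝[univ ×ˢ Icc 0 b] (P, t)) (𝓝 0) := by
    refine squeeze_zero' (Eventually.of_forall fun _ => dist_nonneg) ?_ hclose
    filter_upwards [hclose.eventually_lt_const one_pos, self_mem_nhdsWithin] with p hp hp2
    have := (hΦ P).dist_le (hΦ p.1) hρ hK (by rwa [hΦ0, hΦ0]) p.2 hp2.2
    rwa [hΦ0, hΦ0] at this
  rw [ContinuousWithinAt, tendsto_iff_dist_tendsto_zero] at *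
  rw [tendsto_iff_dist_tendsto_zero] at hP
  refine squeeze_zero (fun _ => dist_nonneg) (fun p => dist_triangle _ (Φ P p.2) _) ?_
  simpa using hdiff.add hP

end Flow

theorem exists_lipschitzOnWith_closedLoop (hf : LipschitzOnCompacts f) {κ : Euc n → Euc m}
    (hκ : ContDiff ℝ 1 κ) (ρ : ℝ) :
    ∃ K, LipschitzOnWith K (fun x => f x (κ x)) (Metric.closedBall 0 ρ) := by
  obtain ⟨L, hL⟩ := hκ.contDiffOn.exists_lipschitzOnWith (s := Metric.closedBall (0 : Euc n) ρ)
    one_ne_zero (convex_closedBall _ _) (isCompact_closedBall _ _)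
  obtain ⟨C, hC0, hC⟩ := hf _ _ (isCompact_closedBall (0 : Euc n) ρ)
    ((isCompact_closedBall (0 : Euc n) ρ).image hκ.continuous)
  refine ⟨(C * (1 + L)).toNNReal, LipschitzOnWith.of_dist_le_mul fun x hx y hy => ?_⟩
  have h1 := hC x hx y hy _ (mem_image_of_mem κ hx) _ (mem_image_of_mem κ hy)
  have h2 := hL.dist_le_mul x hx y hy
  rw [dist_eq_norm, dist_eq_norm] at h2
  rw [dist_eq_norm, dist_eq_norm, Real.coe_toNNReal _ (by positivity)]
  calc _ ≤ _ := h1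
    _ ≤ C * (‖x - y‖ + L * ‖x - y‖) := by gcongr
    _ = _ := by ring

/-- A forward solution with initial value `P`. -/
def IsGloballyAsymptoticallyStable.flow {g : Euc n → Euc n}
    (h : IsGloballyAsymptoticallyStable g) (P : Euc n) : ℝ → Euc n := (h.complete P).choose

namespace IsGloballyAsymptoticallyStable

theorem isForwardSolution_flow {g : Euc n → Euc n} (h : IsGloballyAsymptoticallyStable g)
    (P : Euc n) : IsForwardSolution g (h.flow P) := (h.complete P).choose_spec.1

theorem flow_zero {g : Euc n → Euc n} (h : IsGloballyAsymptoticallyStable g)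
    (P : Euc n) : h.flow P 0 = P := (h.complete P).choose_spec.2

variable {κ : Euc n → Euc m}

theorem isSampleHorizonFlow_flow
    (h : IsGloballyAsymptoticallyStable fun x => f x (κ x))
    (hf : LipschitzOnCompacts f) (hκ : ContDiff ℝ 1 κ)
    (b : ℝ) (P : Euc n) : IsSampleHorizonFlow f κ b P (h.flow P) := by
  have hg := continuous_of_lipschitzOnWith_balls (exists_lipschitzOnWith_closedLoop hf hκ)
  have hsol := h.isForwardSolution_flow P
  have hcont : ContinuousOn (h.flow P) (Ici 0) := fun t ht => (hsol t ht).continuousWithinAt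
  constructor
  · refine ContDiffOn.mono ?_ (Ico_subset_Ici_self : Ico 0 b ⊆ Ici 0)
    rw [contDiffOn_one_iff_derivWithin (uniqueDiffOn_Ici 0)]
    refine ⟨fun t ht => (hsol t ht).differentiableWithinAt, ?_⟩
    exact (hg.comp_continuousOn hcont).congr fun t ht =>
      (hsol t ht).derivWithin (uniqueDiffOn_Ici 0 t ht)
  · intro s hs
    have := eq_integral_of_hasDerivWithinAt
      (hg.comp_continuousOn (hcont.mono Icc_subset_Ici_self)) (hsol.isFlowOn s)
      (right_mem_Icc.2 hs.1)
    rw [this, h.flow_zero]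
    simp only [Function.comp_apply]
    abel

theorem isSampleHorizonFlow_sampleHorizonFlow
    (h : IsGloballyAsymptoticallyStable fun x => f x (κ x))
    (hf : LipschitzOnCompacts f) (hκ : ContDiff ℝ 1 κ)
    (b : ℝ) (P : Euc n) : IsSampleHorizonFlow f κ b P (sampleHorizonFlow f κ b P) := by
  have hex : ∃ Z, IsSampleHorizonFlow f κ b P Z := ⟨_, h.isSampleHorizonFlow_flow hf hκ b P⟩
  rw [sampleHorizonFlow, dif_pos hex]
  exact hex.choose_spec

/-- Uniqueness identifies the chosen solution on `[0, b)` with a flow that is also meaningful at the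
end point `b`. -/
theorem sampleHorizonFlow_eq_flow
    (h : IsGloballyAsymptoticallyStable fun x => f x (κ x))
    (hf : LipschitzOnCompacts f) (hκ : ContDiff ℝ 1 κ)
    {b : ℝ} (P : Euc n) {θ : ℝ} (hθ : θ ∈ Ico 0 b) :
    sampleHorizonFlow f κ b P θ = h.flow P θ := by
  have hlip := exists_lipschitzOnWith_closedLoop hf hκ
  obtain ⟨hZ, hint⟩ := h.isSampleHorizonFlow_sampleHorizonFlow hf hκ b P
  have hsub : Icc 0 θ ⊆ Ico 0 b := fun t ht => ⟨ht.1, ht.2.trans_lt hθ.2⟩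
  have hflow : IsFlowOn (fun x => f x (κ x)) θ (sampleHorizonFlow f κ b P) := fun t ht =>
    hasDerivWithinAt_of_eq_integral (X := P)
      (F := fun t => f (sampleHorizonFlow f κ b P t) (κ (sampleHorizonFlow f κ b P t)))
      ((continuous_of_lipschitzOnWith_balls hlip).comp_continuousOn (hZ.continuousOn.mono hsub))
      (fun s hs => by
        have := hint s (hsub hs)
        rw [sub_sub, sub_eq_zero] at this
        rw [this, add_comm]) ht
  refine ((h.isForwardSolution_flow P).isFlowOn θ).eqOn hlip hflow ?_ (right_mem_Icc.2 hθ.1)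
  rw [h.flow_zero]
  simpa [sub_eq_zero] using hint 0 ⟨le_rfl, hθ.1.trans_lt hθ.2⟩

end IsGloballyAsymptoticallyStable

end Dynamics

/-! ### Networks with neurons indexed by finite sets -/

/-- The shallow network whose neurons are indexed by a finite set. -/
def ShallowNet.ofFinset {J ι ο : Type} (S : Finset J) (w : J → ι → ℝ) (c : J → ℝ)
    (A : ο → J → ℝ) : ShallowNet ι ο where
  width := S.card
  inner := Matrix.of fun i => w (S.equivFin.symm i)
  bias i := c (S.equivFin.symm i)
  outer := Matrix.of fun o i => A o (S.equivFin.symm i)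
  offset := 0

theorem ShallowNet.eval_ofFinset {J ι ο : Type} [Fintype ι] (σ : ℝ → ℝ) (S : Finset J)
    (w : J → ι → ℝ) (c : J → ℝ) (A : ο → J → ℝ) (z : ι → ℝ) (o : ο) :
    (ShallowNet.ofFinset S w c A).eval σ z o = ∑ j ∈ S, A o j * σ (w j ⬝ᵥ z + c j) := by
  rw [← Finset.sum_coe_sort S, ← S.equivFin.symm.sum_comp]
  simp [ShallowNet.eval, ShallowNet.ofFinset, Matrix.mulVec, dotProduct, Matrix.of_apply]
  rfl

/-- Finite linear combinations of neurons with weights in `κ → ℝ`. -/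
abbrev NeuronSum (κ : Type) : Type := ((κ → ℝ) × ℝ) →₀ ℝ

/-- The function given by a finite linear combination of neurons. -/
def NeuronSum.eval {κ : Type} [Fintype κ] (σ : ℝ → ℝ) (R : NeuronSum κ) (z : κ → ℝ) : ℝ :=
  Finsupp.sum R fun q r => r * σ (q.1 ⬝ᵥ z + q.2)

theorem NeuronSum.continuous_eval {κ : Type} [Fintype κ] {σ : ℝ → ℝ} (hσ : Continuous σ)
    (R : NeuronSum κ) : Continuous (R.eval σ) := by
  unfold NeuronSum.eval Finsupp.sum
  refine continuous_finsetSum _ fun q _ => continuous_const.mul (hσ.comp ?_)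
  exact (continuous_const.dotProduct continuous_id).add continuous_const

theorem NeuronSum.eval_smul {κ : Type} [Fintype κ] (σ : ℝ → ℝ) (r : ℝ) (R : NeuronSum κ)
    (z : κ → ℝ) : NeuronSum.eval σ (r • R) z = r * R.eval σ z := by
  unfold NeuronSum.eval
  rw [Finsupp.sum_smul_index (by simp), Finsupp.mul_sum]
  simp [mul_assoc]

/-- Finite linear combinations of neurons acting on finitely many features and on the
position. -/
abbrev FeatureSum (ι : Type) : Type := (((NeuronSum (ι ⊕ Unit) →₀ ℝ) × ℝ) × ℝ) →₀ ℝ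

/-- The function of the values `Ψ` of the features and the position given by a finite linear
combination of neurons. -/
def FeatureSum.eval {ι : Type} (σ : ℝ → ℝ) (Q : FeatureSum ι) (Ψ : NeuronSum (ι ⊕ Unit) → ℝ)
    (x : ℝ) : ℝ :=
  Finsupp.sum Q fun q w => w * σ ((q.1.1.sum fun R e => e * Ψ R) + q.1.2 * x + q.2)

theorem FeatureSum.contDiff_eval {ι : Type} {σ : ℝ → ℝ} (hσ : ContDiff ℝ ∞ σ) (Q : FeatureSum ι)
    (Ψ : NeuronSum (ι ⊕ Unit) → ℝ) : ContDiff ℝ ∞ (Q.eval σ Ψ) := by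
  unfold FeatureSum.eval
  rw [show (fun x => Finsupp.sum Q fun q w =>
      w * σ ((q.1.1.sum fun R e => e * Ψ R) + q.1.2 * x + q.2)) = fun x => ∑ q ∈ Q.support,
      Q q * σ ((q.1.1.sum fun R e => e * Ψ R) + q.1.2 * x + q.2) from rfl]
  fun_prop

theorem setAverage_Icc_eq {a b : ℝ} (hab : a ≤ b) (f : ℝ → ℝ) :
    ⨍ y in Icc a b, f y = (b - a)⁻¹ * ∫ y in a..b, f y := by
  rw [setAverage_eq, intervalIntegral.integral_of_le hab, integral_Icc_eq_integral_Ioc,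
    Real.volume_real_Icc_of_le hab, smul_eq_mul]

theorem setAverage_Icc_apply {ι : Type*} [Fintype ι] {a b : ℝ} (hab : a ≤ b) {v : ℝ → ι → ℝ}
    (hv : ContinuousOn v (Icc a b)) (i : ι) :
    (⨍ y in Icc a b, v y) i = (b - a)⁻¹ * ∫ y in a..b, v y i := by
  rw [← setAverage_Icc_eq hab, setAverage_eq, setAverage_eq, Pi.smul_apply,
    eval_integral fun i => (continuousOn_pi.1 hv i).integrableOn_Icc]

/-- The value of a scalar feature of an input function. -/
def featureValue {ι : Type} [Fintype ι] (σ : ℝ → ℝ) (a b t₀ : ℝ) (u : ℝ → ι → ℝ)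
    (R : NeuronSum (ι ⊕ Unit)) : ℝ :=
  σ (t₀ + (b - a)⁻¹ * ∫ y in a..b, R.eval σ (Sum.elim (u y) fun _ => y))

/-- Finite data of neurons are realised by an averaging neural operator with one layer. -/
theorem exists_neuralOperator_eval_eq {ι ο : Type} [Fintype ι] [Fintype ο] {σ : ℝ → ℝ}
    (hσ : Continuous σ) {a b : ℝ} (hab : a ≤ b) (t₀ : ℝ) (Q : ο → FeatureSum ι) :
    ∃ N : NeuralOperator ι ο, ∀ u : ℝ → ι → ℝ, ContinuousOn u (Icc a b) → ∀ x o,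
      N.eval σ a b u x o = (Q o).eval σ (featureValue σ a b t₀ u) x := by
  classical
  -- Only finitely many items occur: outer neurons `SQ`, the features `SF` they read, and the
  -- lifting neurons `SN` in those features.
  let SQ := Finset.univ.biUnion fun o => (Q o).support
  let SF := SQ.biUnion fun q => q.1.1.support
  let SN := SF.biUnion fun R => R.support
  let e : Fin SF.card → NeuronSum (ι ⊕ Unit) := fun k => SF.equivFin.symm k
  let N : NeuralOperator ι ο :=
    { channels := SF.card
      lifting := ShallowNet.ofFinset SN (fun j => j.1) (fun j => j.2) fun k j => e k j
      -- With zero weight matrix only the average survives, so each channel becomes a constant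
      -- function, the value of one feature.
      layers := [⟨0, fun _ => t₀⟩]
      layers_ne_nil := by simp
      projection := ShallowNet.ofFinset SQ
        (fun q => Sum.elim (fun k => q.1.1 (e k)) fun _ => q.1.2) (fun q => q.2) fun o q => Q o q }
  refine ⟨N, fun u hu x o => ?_⟩
  have hlift : ∀ z, N.lifting.eval σ z = fun k => (e k).eval σ z := fun z => by
    ext k
    rw [ShallowNet.eval_ofFinset, NeuronSum.eval, Finsupp.sum_of_support_subset _ ?_ _ (by simp)]
    exact Finset.subset_biUnion_of_mem (fun R : NeuronSum (ι ⊕ Unit) => R.support)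
      (SF.equivFin.symm k).2
  have hpt : ContinuousOn (fun y => (Sum.elim (u y) fun _ => y : ι ⊕ Unit → ℝ)) (Icc a b) := by
    refine continuousOn_pi.2 fun i => ?_
    rcases i with i | i
    · exact (continuous_apply i).comp_continuousOn hu
    · exact continuousOn_id
  have hlayer : ∀ y, AveragingLayer.apply σ a b (⟨0, fun _ => t₀⟩ : AveragingLayer SF.card)
      (fun y => N.lifting.eval σ (Sum.elim (u y) fun _ => y)) y
      = fun k => featureValue σ a b t₀ u (e k) := fun y => by
    ext k
    have hc : ContinuousOn (fun y => (fun k => (e k).eval σ (Sum.elim (u y) fun _ => y) :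
        Fin SF.card → ℝ)) (Icc a b) :=
      continuousOn_pi.2 fun k => ((e k).continuous_eval hσ).comp_continuousOn hpt
    simp only [AveragingLayer.apply, hlift, Matrix.zero_mulVec, zero_add, Pi.add_apply,
      featureValue]
    rw [setAverage_Icc_apply hab hc]
  have hN : N.eval σ a b u x o = N.projection.eval σ
      (Sum.elim (fun k => featureValue σ a b t₀ u (e k)) fun _ => x) o := by
    rw [← hlayer x]
    rfl
  rw [hN, ShallowNet.eval_ofFinset, FeatureSum.eval, Finsupp.sum_of_support_subset _
    (Finset.subset_biUnion_of_mem (fun o => (Q o).support) (Finset.mem_univ o)) _ (by simp)]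
  refine Finset.sum_congr rfl fun q hq => ?_
  rw [Finsupp.sum_of_support_subset _
    (Finset.subset_biUnion_of_mem (fun q : ((NeuronSum (ι ⊕ Unit) →₀ ℝ) × ℝ) × ℝ =>
      q.1.1.support) hq) _ (by simp)]
  congr 3
  rw [← Finset.sum_coe_sort, ← SF.equivFin.symm.sum_comp]
  simp only [dotProduct, Fintype.sum_sum_type, Sum.elim_inl, Sum.elim_inr, Finset.univ_unique,
    Finset.sum_singleton]
  rfl

/-! ### Universal approximation -/

section Approximation

variable {σ : ℝ → ℝ}

/-- Universal approximation on a compact space, by neurons whose arguments depend linearly on a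
parameter. -/
theorem exists_finsupp_approx (hσ : ContDiff ℝ ∞ σ)
    (hpoly : ¬ ∃ p : Polynomial ℝ, ∀ x, σ x = p.eval x)
    {T : Type*} [TopologicalSpace T] [CompactSpace T] {W : Type*} [AddCommGroup W] [Module ℝ W]
    (L : W →ₗ[ℝ] C(T, ℝ)) (hL : ∀ x y : T, x ≠ y → ∃ w, L w x ≠ L w y) (g : C(T, ℝ)) {ε : ℝ}
    (hε : 0 < ε) :
    ∃ F : (W × ℝ) →₀ ℝ, ∀ t, |g t - F.sum fun q r => r * σ (L q.1 t + q.2)| < ε := by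
  let σ' : C(ℝ, ℝ) := ⟨σ, hσ.continuous⟩
  have hdense := dense_span_activated (σ := σ') hσ hpoly (LinearMap.range L) fun x y hxy => by
    obtain ⟨w, hw⟩ := hL x y hxy
    exact ⟨L w, ⟨w, rfl⟩, hw⟩
  have hrange : (range fun a : LinearMap.range L × ℝ => activated σ' (a.1 : C(T, ℝ)) a.2)
      = range fun q : W × ℝ => activated σ' (L q.1) q.2 := by
    ext p
    constructor
    · rintro ⟨⟨⟨_, w, rfl⟩, c⟩, rfl⟩
      exact ⟨(w, c), rfl⟩
    · rintro ⟨⟨w, c⟩, rfl⟩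
      exact ⟨(⟨L w, w, rfl⟩, c), rfl⟩
  rw [hrange] at hdense
  have hg : g ∈ closure (Submodule.span ℝ
      (range fun q : W × ℝ => activated σ' (L q.1) q.2) : Set C(T, ℝ)) := by
    rw [← Submodule.topologicalClosure_coe, hdense]
    trivial
  obtain ⟨s, hs, hgs⟩ := Metric.mem_closure_iff.1 hg ε hε
  obtain ⟨F, rfl⟩ := Finsupp.mem_span_range_iff_exists_finsupp.1 hs
  refine ⟨F, fun t => ?_⟩
  have := (ContinuousMap.dist_apply_le_dist t).trans_lt hgs
  rw [Real.dist_eq, Finsupp.sum, ContinuousMap.sum_apply] at this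
  exact this

/-- The coordinate functionals separate the points of `B`. -/
theorem exists_neuronSum_approx (hσ : ContDiff ℝ ∞ σ)
    (hpoly : ¬ ∃ p : Polynomial ℝ, ∀ x, σ x = p.eval x)
    {κ : Type} [Fintype κ] {B : Set (κ → ℝ)} (hB : IsCompact B) {g : (κ → ℝ) → ℝ}
    (hg : Continuous g) {ε : ℝ} (hε : 0 < ε) :
    ∃ R : NeuronSum κ, ∀ z ∈ B, |g z - R.eval σ z| < ε := by
  classical
  have := isCompact_iff_compactSpace.1 hB
  let L : (κ → ℝ) →ₗ[ℝ] C(B, ℝ) :=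
    { toFun w := ⟨fun z => w ⬝ᵥ (z : κ → ℝ),
        continuous_const.dotProduct continuous_subtype_val⟩
      map_add' _ _ := by ext; simp [add_dotProduct]
      map_smul' _ _ := by ext; simp [smul_dotProduct] }
  obtain ⟨R, hR⟩ := exists_finsupp_approx hσ hpoly L (fun x y hxy => by
    obtain ⟨i, hi⟩ := Function.ne_iff.1 fun h => hxy (Subtype.ext h)
    exact ⟨Pi.single i 1, by simpa [L] using hi⟩) ⟨fun z => g z, hg.comp continuous_subtype_val⟩ hε
  exact ⟨R, fun z hz => hR ⟨z, hz⟩⟩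

theorem exists_deriv_ne_zero (hσ : Differentiable ℝ σ)
    (hpoly : ¬ ∃ p : Polynomial ℝ, ∀ x, σ x = p.eval x) : ∃ t, deriv σ t ≠ 0 := by
  by_contra! h
  exact hpoly ⟨Polynomial.C (σ 0), fun x => by
    simpa using is_const_of_deriv_eq_zero hσ h x 0⟩

/-- Otherwise differentiation at `r = 0` gives `σ'(t₀) p = σ'(t₀) q`. Thus distinct averages yield
distinct features even when `σ` is not injective. -/
theorem exists_scaling_ne {t₀ p q : ℝ} (ht₀ : deriv σ t₀ ≠ 0) (hpq : p ≠ q) :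
    ∃ r : ℝ, σ (t₀ + r * p) ≠ σ (t₀ + r * q) := by
  by_contra! h
  have hd : ∀ s : ℝ, HasDerivAt (fun r => σ (t₀ + r * s)) (deriv σ t₀ * s) 0 := fun s => by
    have h1 : HasDerivAt (fun r : ℝ => t₀ + r * s) s 0 := by
      simpa using ((hasDerivAt_id (0 : ℝ)).mul_const s).const_add t₀
    have h2 : HasDerivAt σ (deriv σ t₀) (t₀ + 0 * s) := by
      simpa using (differentiableAt_of_deriv_ne_zero ht₀).hasDerivAt
    exact h2.comp 0 h1
  have h1 := hd p
  rw [funext h] at h1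
  exact hpq (mul_left_cancel₀ ht₀ (h1.unique (hd q)))

variable {A : Type*} [TopologicalSpace A] {ι : Type} {a b : ℝ}

/-- The input value and the position at the point of `[a, b]` closest to `y`. -/
def inputPoint (hab : a ≤ b) (w : C(A × Icc a b, ι → ℝ)) (α : A) (y : ℝ) : ι ⊕ Unit → ℝ :=
  Sum.elim (w (α, projIcc a b hab y)) fun _ => projIcc a b hab y

theorem continuous_inputPoint (hab : a ≤ b) (w : C(A × Icc a b, ι → ℝ)) :
    Continuous fun p : A × ℝ => inputPoint hab w p.1 p.2 := by
  have hproj : Continuous fun p : A × ℝ => projIcc a b hab p.2 :=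
    continuous_projIcc.comp continuous_snd
  refine continuous_pi fun i => ?_
  rcases i with i | i
  · exact (continuous_apply i).comp (w.continuous.comp (continuous_fst.prodMk hproj))
  · exact continuous_subtype_val.comp hproj

theorem integral_inputPoint_eq (hab : a ≤ b) (w : C(A × Icc a b, ι → ℝ)) (α : A)
    {u : ℝ → ι → ℝ} (hu : ∀ y : Icc a b, u y = w (α, y)) (F : (ι ⊕ Unit → ℝ) → ℝ) :
    ∫ y in a..b, F (Sum.elim (u y) fun _ => y) = ∫ y in a..b, F (inputPoint hab w α y) := by
  refine intervalIntegral.integral_congr fun y hy => ?_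
  rw [uIcc_of_le hab] at hy
  simp only [inputPoint, projIcc_of_mem hab hy, ← hu]

variable [Fintype ι]

/-- Averages of shallow networks separate input functions. -/
theorem exists_integral_neuronSum_ne (hσ : ContDiff ℝ ∞ σ)
    (hpoly : ¬ ∃ p : Polynomial ℝ, ∀ x, σ x = p.eval x) (hab : a < b)
    (w : C(A × Icc a b, ι → ℝ)) [CompactSpace A] {α β : A} {y : Icc a b}
    (hne : w (α, y) ≠ w (β, y)) :
    ∃ R : NeuronSum (ι ⊕ Unit), ∫ y in a..b, R.eval σ (inputPoint hab.le w α y)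
      ≠ ∫ y in a..b, R.eval σ (inputPoint hab.le w β y) := by
  obtain ⟨i, hi⟩ := Function.ne_iff.1 hne
  have hc := continuous_inputPoint hab.le w
  have hcα : ∀ α, Continuous (inputPoint hab.le w α) := fun α =>
    hc.comp (continuous_const.prodMk continuous_id)
  -- Weighting the `i`-th input coordinate by `φ` at the position makes the two integrals of `g`
  -- differ by the integral of `φ ^ 2`.
  let φ : ℝ → ℝ := fun y => inputPoint hab.le w α y (Sum.inl i) - inputPoint hab.le w β y (Sum.inl i)
  have hφ : Continuous φ :=
    ((continuous_apply _).comp (hcα α)).sub ((continuous_apply _).comp (hcα β))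
  let g : (ι ⊕ Unit → ℝ) → ℝ := fun z => z (Sum.inl i) * φ (z (Sum.inr ()))
  have hg : Continuous g := (continuous_apply _).mul (hφ.comp (continuous_apply _))
  have hB : IsCompact ((fun p : A × ℝ => inputPoint hab.le w p.1 p.2) '' univ ×ˢ Icc a b) :=
    (isCompact_univ.prod isCompact_Icc).image hc
  have hint : ∀ F : (ι ⊕ Unit → ℝ) → ℝ, Continuous F → ∀ α,
      IntervalIntegrable (fun y => F (inputPoint hab.le w α y)) volume a b := fun F hF α =>
    (hF.comp (hcα α)).intervalIntegrable _ _
  have hpos : 0 < (∫ y in a..b, g (inputPoint hab.le w α y))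
      - ∫ y in a..b, g (inputPoint hab.le w β y) := by
    rw [← intervalIntegral.integral_sub (hint g hg α) (hint g hg β)]
    have heq : ∀ t ∈ Icc a b, g (inputPoint hab.le w α t) - g (inputPoint hab.le w β t)
        = φ t ^ 2 := fun t ht => by
      have hval : ∀ γ, inputPoint hab.le w γ t (Sum.inr ()) = t := fun γ => by
        simp [inputPoint, projIcc_of_mem hab.le ht]
      simp only [g, hval]
      rw [← sub_mul, sq]
    refine intervalIntegral.integral_pos hab
      ((hg.comp (hcα α)).sub (hg.comp (hcα β))).continuousOn (fun t ht => ?_) ⟨y, y.2, ?_⟩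
    · rw [heq t (Ioc_subset_Icc_self ht)]
      positivity
    · rw [heq y y.2]
      have : φ y ≠ 0 := by
        simp only [φ, inputPoint, projIcc_val, Sum.elim_inl]
        exact sub_ne_zero.2 hi
      positivity
  set δ := (∫ y in a..b, g (inputPoint hab.le w α y))
      - ∫ y in a..b, g (inputPoint hab.le w β y) with hδ
  have hba : 0 < b - a := sub_pos.2 hab
  -- Each integral changes by at most `δ / 3`, too little to close the gap `δ`.
  obtain ⟨R, hR⟩ := exists_neuronSum_approx hσ hpoly hB hg (ε := δ / (3 * (b - a))) (by positivity)
  have hRc := R.continuous_eval hσ.continuous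
  have hclose : ∀ γ, |(∫ y in a..b, g (inputPoint hab.le w γ y))
      - ∫ y in a..b, R.eval σ (inputPoint hab.le w γ y)| ≤ δ / 3 := fun γ => by
    rw [← intervalIntegral.integral_sub (hint g hg γ) (hint _ hRc γ)]
    have := intervalIntegral.norm_integral_le_of_norm_le_const (a := a) (b := b)
      (C := δ / (3 * (b - a)))
      (f := fun y => g (inputPoint hab.le w γ y) - R.eval σ (inputPoint hab.le w γ y))
      (fun y hy => by
        rw [uIoc_of_le hab.le] at hy
        exact (hR _ ⟨(γ, y), ⟨mem_univ _, Ioc_subset_Icc_self hy⟩, rfl⟩).le)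
    rw [Real.norm_eq_abs, abs_of_pos hba] at this
    refine this.trans_eq ?_
    field_simp
  refine ⟨R, fun heq => ?_⟩
  have h1 := abs_le.1 (hclose α)
  have h2 := abs_le.1 (hclose β)
  rw [heq] at h1
  linarith [h1.1, h1.2, h2.1, h2.2]

/-- Universal approximation for averaging neural operators: a continuous map on a compact set of
continuous input functions is approximated uniformly. The approximating operators have smooth
outputs. -/
theorem exists_neuralOperator_approx (hσ : ContDiff ℝ ∞ σ)
    (hpoly : ¬ ∃ p : Polynomial ℝ, ∀ x, σ x = p.eval x) (hab : a < b)
    [CompactSpace A] [FirstCountableTopology A] [R1Space A] {ο : Type} [Fintype ο]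
    (w : C(A × Icc a b, ι → ℝ)) (hw : ∀ α β : A, α ≠ β → ∃ y, w (α, y) ≠ w (β, y))
    (G : ο → C(A × Icc a b, ℝ)) {ε : ℝ} (hε : 0 < ε) :
    ∃ N : NeuralOperator ι ο, ∀ (α : A) (u : ℝ → ι → ℝ), (∀ y : Icc a b, u y = w (α, y)) →
      (∀ o, ContDiff ℝ ∞ fun x => N.eval σ a b u x o) ∧
      ∀ (x : Icc a b) o, |G o (α, x) - N.eval σ a b u x o| < ε := by
  obtain ⟨t₀, ht₀⟩ := exists_deriv_ne_zero (hσ.differentiable (by simp)) hpoly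
  have hfeat : ∀ R : NeuronSum (ι ⊕ Unit), Continuous fun α : A =>
      σ (t₀ + (b - a)⁻¹ * ∫ y in a..b, R.eval σ (inputPoint hab.le w α y)) := fun R => by
    refine hσ.continuous.comp (continuous_const.add (continuous_const.mul ?_))
    exact intervalIntegral.continuous_parametric_intervalIntegral_of_continuous'
      (f := fun α y => R.eval σ (inputPoint hab.le w α y))
      ((R.continuous_eval hσ.continuous).comp (continuous_inputPoint hab.le w)) a b
  let Ψ : NeuronSum (ι ⊕ Unit) → C(A × Icc a b, ℝ) := fun R =>
    ⟨fun p => σ (t₀ + (b - a)⁻¹ * ∫ y in a..b, R.eval σ (inputPoint hab.le w p.1 y)),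
      (hfeat R).comp continuous_fst⟩
  let pos : C(A × Icc a b, ℝ) := ⟨fun p => p.2, continuous_subtype_val.comp continuous_snd⟩
  -- Arguments of the outer neurons: finite combinations of all possible features, which see only
  -- the input, plus a multiple of the position.
  let L : ((NeuronSum (ι ⊕ Unit) →₀ ℝ) × ℝ) →ₗ[ℝ] C(A × Icc a b, ℝ) :=
    (Finsupp.linearCombination ℝ Ψ).coprod (LinearMap.toSpanSingleton ℝ _ pos)
  have hLapp : ∀ q p, L q p = (q.1.sum fun R e => e * Ψ R p) + q.2 * p.2 := fun q p => by
    simp [L, Finsupp.linearCombination_apply, Finsupp.sum, pos, ContinuousMap.sum_apply]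
  have hsep : ∀ p q : A × Icc a b, p ≠ q → ∃ v, L v p ≠ L v q := by
    rintro ⟨α, x⟩ ⟨β, y⟩ hne
    by_cases hαβ : α = β
    · refine ⟨(0, 1), fun h => hne (Prod.ext hαβ (Subtype.ext ?_))⟩
      simpa [hLapp] using h
    · obtain ⟨z, hz⟩ := hw α β hαβ
      obtain ⟨R, hR⟩ := exists_integral_neuronSum_ne hσ hpoly hab w hz
      have hba : (b - a)⁻¹ ≠ 0 := inv_ne_zero (sub_pos.2 hab).ne'
      obtain ⟨r, hr⟩ := exists_scaling_ne ht₀ fun h => hR (mul_left_cancel₀ hba h)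
      have hΨ : ∀ γ x, Ψ (r • R) (γ, x) = σ (t₀ + r * ((b - a)⁻¹ *
          ∫ y in a..b, R.eval σ (inputPoint hab.le w γ y))) := fun γ x => by
        simp only [Ψ, ContinuousMap.coe_mk, NeuronSum.eval_smul,
          intervalIntegral.integral_const_mul]
        ring_nf
      refine ⟨(Finsupp.single (r • R) 1, 0), ?_⟩
      simpa [hLapp, hΨ] using hr
  choose Q hQ using fun o => exists_finsupp_approx hσ hpoly L hsep (G o) hε
  obtain ⟨N, hN⟩ := exists_neuralOperator_eval_eq hσ.continuous hab.le t₀ Q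
  refine ⟨N, fun α u hu => ?_⟩
  have huc : ContinuousOn u (Icc a b) := by
    rw [continuousOn_iff_continuous_domRestrict]
    have : Set.domRestrict (Icc a b) u = fun y => w (α, y) := funext hu
    rw [this]
    exact w.continuous.comp (continuous_const.prodMk continuous_id)
  have hNu := hN u huc
  refine ⟨fun o => ?_, fun x o => ?_⟩
  -- For a fixed input the features are constants, so `x` enters only through the outer neurons.
  · simp only [hNu]
    exact FeatureSum.contDiff_eval hσ (Q o) _
  · have hval : N.eval σ a b u x o = (Q o).sum fun q r => r * σ (L q.1 (α, x) + q.2) := by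
      rw [hNu, FeatureSum.eval]
      simp only [hLapp]
      refine Finsupp.sum_congr fun q _ => ?_
      have hΨ : ∀ R, featureValue σ a b t₀ u R = Ψ R (α, x) := fun R => by
        rw [featureValue, integral_inputPoint_eq hab.le w α hu]
        rfl
      simp only [hΨ]
    rw [hval]
    exact hQ o (α, x)

end Approximation

/-! ### The sampling-horizon prediction as a continuous function -/

/-- The input `(X, U(y))` of the neural operator as a continuous function of `(X, U)` and `y`. -/
def predictionInput {n m : ℕ} {a b : ℝ} (K : Set (Euc n × C1Space a b (Euc m))) :
    C(K × Icc a b, Fin n ⊕ Fin m → ℝ) where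
  toFun p := Sum.elim (fun i => p.1.1.1 i) fun j => p.1.1.2.1.1 p.2 j
  continuous_toFun := by
    refine continuous_pi fun i => ?_
    rcases i with i | j
    · have : Continuous fun p : K × Icc a b => p.1.1.1 :=
        continuous_fst.comp (continuous_subtype_val.comp continuous_fst)
      exact (EuclideanSpace.proj (𝕜 := ℝ) i).continuous.comp this
    · have h1 : Continuous fun p : K × Icc a b => p.1.1.2.1.1 :=
        continuous_fst.comp (continuous_subtype_val.comp
          (continuous_snd.comp (continuous_subtype_val.comp continuous_fst)))
      have h2 : Continuous fun p : K × Icc a b => p.1.1.2.1.1 p.2 := h1.eval continuous_snd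
      exact (EuclideanSpace.proj (𝕜 := ℝ) j).continuous.comp h2

theorem predictionInput_separates {n m : ℕ} {a b : ℝ} (hab : a < b)
    (K : Set (Euc n × C1Space a b (Euc m))) (p q : K) (hpq : p ≠ q) :
    ∃ y, predictionInput K (p, y) ≠ predictionInput K (q, y) := by
  by_contra! h
  refine hpq (Subtype.ext (Prod.ext ?_ (C1Space.ext_eval hab fun t ht => ?_)))
  · ext i
    exact congrFun (h ⟨a, left_mem_Icc.2 hab.le⟩) (Sum.inl i)
  · rw [C1Space.eval_apply _ ht, C1Space.eval_apply _ ht]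
    ext j
    exact congrFun (h ⟨t, ht⟩) (Sum.inr j)

/-- The time `h / D * (x + D)` inverts the transport from `[0, h)` to `[-D, 0)`. Using `hgas.flow`
keeps the function continuous up to `x = 0`, that is time `h`, so that its domain is compact when
`K` is. -/
theorem continuous_flow_predictor {n m : ℕ} {f : Euc n → Euc m → Euc n} {κ : Euc n → Euc m}
    {D h : ℝ} (hD : 0 < D) (hh : 0 < h) (hf : LipschitzOnCompacts f)
    (hfc : StronglyForwardComplete f) (hκ : ContDiff ℝ 1 κ)
    (hgas : IsGloballyAsymptoticallyStable (fun x => f x (κ x)))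
    (K : Set (Euc n × C1Space (-D) 0 (Euc m))) :
    Continuous fun p : K × Icc (-D) 0 =>
      hgas.flow (C1Space.eval (predictor f D p.1.1.1 p.1.1.2) 0) (h / D * (p.2 + D)) := by
  have hflow := continuousOn_flow (exists_lipschitzOnWith_closedLoop hf hκ) (b := h) hgas.flow
    (fun P => (hgas.isForwardSolution_flow P).isFlowOn h) hgas.flow_zero
  have h1 : Continuous fun p : K × Icc (-D) 0 =>
      C1Space.eval (predictor f D p.1.1.1 p.1.1.2) 0 :=
    (continuous_predictor_eval_zero hf hfc hD.le).comp
      (continuous_subtype_val.comp continuous_fst)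
  have h2 : Continuous fun p : K × Icc (-D) 0 => h / D * ((p.2 : ℝ) + D) := by fun_prop
  refine hflow.comp_continuous (h1.prodMk h2) fun p => ⟨mem_univ _, ?_, ?_⟩
  · have := p.2.2.1
    have : 0 ≤ (p.2 : ℝ) + D := by linarith
    positivity
  · have := p.2.2.2
    calc h / D * ((p.2 : ℝ) + D) ≤ h / D * D := by gcongr; linarith
      _ = h := div_mul_cancel₀ _ hD.ne'

theorem norm_le_sum_abs {n : ℕ} (x : Euc n) : ‖x‖ ≤ ∑ i, |x i| := by
  rw [EuclideanSpace.norm_eq, Real.sqrt_le_left (Finset.sum_nonneg fun _ _ => abs_nonneg _)]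
  exact Finset.sum_sq_le_sq_sum_of_nonneg fun _ _ => abs_nonneg _

end

/-! ### The approximation theorem -/

theorem lemma3 {n m : ℕ} (f : Euc n → Euc m → Euc n) (κ : Euc n → Euc m) (D h : ℝ)
    (hD : 0 < D) (hh : 0 < h)
    (hf : LipschitzOnCompacts f) (hfc : StronglyForwardComplete f)
    (hκ : ContDiff ℝ 1 κ)
    (hgas : IsGloballyAsymptoticallyStable (fun x => f x (κ x)))
    (σ : ℝ → ℝ) (hσ : ContDiff ℝ ∞ σ)
    (hσpoly : ¬ ∃ p : Polynomial ℝ, ∀ x, σ x = p.eval x)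
    (𝒳 : Set (Euc n)) (𝒰 : Set (Euc m))
    (h𝒳 : Bornology.IsBounded 𝒳) (h𝒰 : Bornology.IsBounded 𝒰)
    (K : Set (Euc n × C1Space (-D) 0 (Euc m))) (hK : IsCompact K)
    (hKsub : ∀ p ∈ K, p.1 ∈ 𝒳 ∧ ∀ t ∈ Set.Icc (-D) 0, C1Space.eval p.2 t ∈ 𝒰) :
    (∀ X U, IsPredictor f D X U (predictor f D X U)) ∧
    (∀ P, IsSampleHorizonFlow f κ h P (sampleHorizonFlow f κ h P)) ∧
    ∀ ε : ℝ, 0 < ε → ∃ N : NeuralOperator (Fin n ⊕ Fin m) (Fin n),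
      (∀ p ∈ K, ContDiffOn ℝ 1 (N.horizonMap σ D h p.1 p.2) (Set.Ico 0 h)) ∧
      ∀ θ ∈ Set.Ico 0 h,
        BddAbove ((fun p => ‖samplingHorizonPrediction f κ D h p.1 p.2 θ
          - N.horizonMap σ D h p.1 p.2 θ‖) '' K) ∧
        sSup ((fun p => ‖samplingHorizonPrediction f κ D h p.1 p.2 θ
          - N.horizonMap σ D h p.1 p.2 θ‖) '' K) < ε := by
  refine ⟨isPredictor_predictor hf hfc hD.le,
    hgas.isSampleHorizonFlow_sampleHorizonFlow hf hκ h, fun ε hε => ?_⟩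
  have hab : -D < 0 := neg_lt_zero.2 hD
  have := isCompact_iff_compactSpace.1 hK
  let G : Fin n → C(K × Icc (-D) 0, ℝ) := fun o =>
    ⟨fun p => hgas.flow (C1Space.eval (predictor f D p.1.1.1 p.1.1.2) 0) (h / D * (p.2 + D)) o,
      (EuclideanSpace.proj (𝕜 := ℝ) o).continuous.comp
        (continuous_flow_predictor hD hh hf hfc hκ hgas K)⟩
  obtain ⟨N, hN⟩ := exists_neuralOperator_approx hσ hσpoly hab (predictionInput K)
    -- The sum of `n` coordinate errors is at most `ε / 2`; `n + 1` keeps the denominator nonzero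
    -- when `n = 0`.
    (predictionInput_separates hab K) G (ε := ε / (2 * (n + 1))) (by positivity)
  let u : K → ℝ → Fin n ⊕ Fin m → ℝ := fun p y =>
    Sum.elim (fun i => p.1.1 i) fun j => C1Space.eval p.1.2 y j
  have hinput : ∀ (p : K) (y : Icc (-D) 0), u p y = predictionInput K (p, y) := fun p y => by
    simp only [u]
    rw [C1Space.eval_apply _ y.2]
    rfl
  have hclose : ∀ θ ∈ Ico 0 h, ∀ p ∈ K, ‖samplingHorizonPrediction f κ D h p.1 p.2 θ
      - N.horizonMap σ D h p.1 p.2 θ‖ ≤ ε / 2 := by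
    intro θ hθ p hp
    have hx : -D + D / h * θ ∈ Icc (-D) 0 := by
      constructor
      · have := hθ.1
        have : 0 ≤ D / h * θ := by positivity
        linarith
      · have : D / h * θ ≤ D / h * h := by
          have := hθ.2.le
          gcongr
        rw [div_mul_cancel₀ _ hh.ne'] at this
        linarith
    have hθ' : h / D * (-D + D / h * θ + D) = θ := by
      field_simp
      ring
    rw [samplingHorizonPrediction, hgas.sampleHorizonFlow_eq_flow hf hκ _ hθ]
    have hcoord : ∀ o, |(hgas.flow (C1Space.eval (predictor f D p.1 p.2) 0) θ
        - N.horizonMap σ D h p.1 p.2 θ) o| ≤ ε / (2 * (n + 1)) := fun o => by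
      have := ((hN ⟨p, hp⟩ (u ⟨p, hp⟩) (hinput ⟨p, hp⟩)).2 ⟨_, hx⟩ o).le
      change |hgas.flow _ (h / D * (-D + D / h * θ + D)) o - _| ≤ _ at this
      rw [hθ'] at this
      exact this
    refine (norm_le_sum_abs _).trans ?_
    calc _ ≤ ∑ _o : Fin n, ε / (2 * (n + 1)) := Finset.sum_le_sum fun o _ => hcoord o
      _ = n * (ε / (2 * (n + 1))) := by simp
      _ ≤ (n + 1) * (ε / (2 * (n + 1))) := by gcongr; linarith
      _ = ε / 2 := by field_simp
  refine ⟨N, fun p hp => ?_, fun θ hθ => ⟨⟨ε / 2, ?_⟩, ?_⟩⟩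
  · have hsmooth : ContDiff ℝ ∞ (N.horizonMap σ D h p.1 p.2) := by
      rw [contDiff_piLp]
      intro o
      exact ((hN ⟨p, hp⟩ (u ⟨p, hp⟩) (hinput ⟨p, hp⟩)).1 o).comp
        (contDiff_const.add (contDiff_const.mul contDiff_id))
    exact (hsmooth.of_le (by exact_mod_cast le_top)).contDiffOn
  · rintro _ ⟨p, hp, rfl⟩
    exact hclose θ hθ p hp
  -- The margin `ε / 2` keeps the supremum strictly below `ε`; its nonnegativity covers empty `K`,
  -- where `sSup` is `0`.
  · refine (Real.sSup_le ?_ (by positivity)).trans_lt (half_lt_self hε)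
    rintro _ ⟨p, hp, rfl⟩
    exact hclose θ hθ p hp
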